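/- Let $K$ be a field and let $\Sigma$ be a finite alphabet with the discrete topology. A subshift is a non-empty closed subset $X\subseteq\Sigma^{\mathbb Z}$ that is invariant under the shift $T$ and its inverse. It is minimal if it contains no non-empty proper subshift, and its entropy is the topological entropy of $T|_X$. The monomial algebra $A_X$ is the quotient of the free unital algebra $K\langle \Sigma\rangle$ by the two-sided ideal generated by all words that are not factors of any point of $X$. Let $A_n\subseteq A_X$ be the span of the monomials of length $n$. A module $M\neq 0$ over a unital associative $K$-algebra $A$ is called exhaustively amenable if for every $\varepsilon>0$ and all finite-dimensional subspaces $V\le A$, $W\le M$ there is a finite-dimensional subspace $L\le M$ containing $W$ with $\dim_K LV<(1+\varepsilon)\dim_K L$ (with $VL$ in place of $LV$ for left modules), where $LV$ is the span of the products. **(1)** Suppose that $X$ is a minimal subshift of positive entropy. Then: - $A_X=\bigoplus_{n\ge 0}A_n$ is a graded algebra, and it is projectively simple: it is infinite-dimensional and each of its non-zero homogeneous two-sided ideals has finite codimension. - $A_X$ is finitely generated and of exponential growth: for every finite-dimensional generating subspace $V\ni 1$ there is $\beta>1$ with $\dim_K V^n\ge\beta^n$ for all large $n$. - Every non-zero right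 $A_X$-module and every non-zero left $A_X$-module is exhaustively amenable. - Let $\varepsilon\colon A_X\to K$ be the augmentation that sends every letter to $0$, and let $\varpi=\ker\varepsilon$. Then the associated graded algebra $\bigoplus_{n\ge0}\varpi^n/\varpi^{n+1}$ has exponential growth: there is $\beta>1$ with $\sum_{i\le n}\dim_K\varpi^i/\varpi^{i+1}\ge\beta^n$ for all large $n$. **(2)** Consequently Bartholdi's extension of Vershik's conjecture fails over every field $K$, even for the strictest notion of amenability. That is, the following assertion is false: whenever $A$ is a finitely generated $K$-algebra over which all non-zero right modules and all non-zero left modules are exhaustively amenable, and $\varepsilon\colon A\to K$ is an algebra homomorphism with kernel $\varpi$, the graded algebra $\bigoplus_{n\ge0}\varpi^n/\varpi^{n+1}$ has subexponential growth (that is, for every $\beta>1$, $\sum_{i\le n}\dim_K\varpi^i/\varpi^{i+1}\le\beta^n$ for all large $n$). -/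

import Mathlib

open SymbolicDynamics.FullShift Filter

/-! ### Subshifts

A subshift over the alphabet `S` is Mathlib's `Subshift S ℤ`: a closed subset of `ℤ → S` which is
invariant under all translations by integers. -/

/-- A subshift is minimal if it is non-empty and contains no non-empty proper subshift. -/
def IsMinimalSubshift {S : Type*} [TopologicalSpace S] (X : Subshift S ℤ) : Prop :=
  X.carrier.Nonempty ∧
    ∀ Y : Subshift S ℤ, Y.carrier.Nonempty → Y.carrier ⊆ X.carrier → Y.carrier = X.carrier

/-- The topological entropy of the shift map `T`, `(T x) i = x (1 + i)`, on the subshift `X`. -/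
noncomputable def subshiftEntropy {S : Type*} [UniformSpace S] (X : Subshift S ℤ) : EReal :=
  Dynamics.coverEntropy (shift (1 : ℤ) : (ℤ → S) → (ℤ → S)) X.carrier

/-- The finite word `w` is a factor of some point of `X`. -/
def IsFactor {S : Type*} [TopologicalSpace S] (X : Subshift S ℤ) (w : List S) : Prop :=
  ∃ x ∈ X.carrier, ∃ i : ℤ, ∀ (k : ℕ) (hk : k < w.length), w[k] = x (i + k)

/-! ### The monomial algebra of a subshift -/

/-- The monomial `x_{s₁} ⋯ x_{sₙ}` of the free algebra attached to the word `s₁ ⋯ sₙ`. -/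
noncomputable def freeMonomial (K : Type*) [Field K] {S : Type*} (w : List S) : FreeAlgebra K S :=
  (w.map (FreeAlgebra.ι K)).prod

/-- The monomial relations: every word which is not a factor of `X` is set to be `0`. -/
inductive SubshiftRel (K : Type*) [Field K] {S : Type*} [TopologicalSpace S]
    (X : Subshift S ℤ) : FreeAlgebra K S → FreeAlgebra K S → Prop
  | of_not_factor (w : List S) (hw : ¬ IsFactor X w) : SubshiftRel K X (freeMonomial K w) 0

/-- The monomial algebra `A_X`: the quotient of the free algebra on the alphabet by the two-sided
ideal generated by the words which are not factors of `X`. -/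
abbrev SubshiftAlgebra (K : Type*) [Field K] {S : Type*} [TopologicalSpace S]
    (X : Subshift S ℤ) : Type _ :=
  RingQuot (SubshiftRel K X)

/-- The image in `A_X` of the monomial attached to a word. -/
noncomputable def SubshiftAlgebra.monomial (K : Type*) [Field K] {S : Type*} [TopologicalSpace S]
    (X : Subshift S ℤ) (w : List S) : SubshiftAlgebra K X :=
  RingQuot.mkAlgHom K (SubshiftRel K X) (freeMonomial K w)

/-- The subspace of `A_X` spanned by the monomials of length `n`. -/
def SubshiftAlgebra.component (K : Type*) [Field K] {S : Type*} [TopologicalSpace S]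
    (X : Subshift S ℤ) (n : ℕ) : Submodule K (SubshiftAlgebra K X) :=
  Submodule.span K {a | ∃ w : List S, w.length = n ∧ a = SubshiftAlgebra.monomial K X w}

/-! ### Graded and projectively simple algebras -/

/-- `A = ⨁ 𝒜 n` as a vector space, `1 ∈ 𝒜 0` and `𝒜 m * 𝒜 n ⊆ 𝒜 (m + n)`. -/
def IsAlgebraGrading {K : Type*} [Field K] {A : Type*} [Ring A] [Algebra K A]
    (𝒜 : ℕ → Submodule K A) : Prop :=
  SetLike.GradedMonoid 𝒜 ∧ DirectSum.IsInternal 𝒜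

/-- A two-sided ideal is homogeneous if it is generated by its homogeneous elements. -/
def IsHomogeneousTwoSided {K : Type*} [Field K] {A : Type*} [Ring A] [Algebra K A]
    (𝒜 : ℕ → Submodule K A) (I : TwoSidedIdeal A) : Prop :=
  TwoSidedIdeal.span {a : A | a ∈ I ∧ SetLike.IsHomogeneousElem 𝒜 a} = I

/-- A graded algebra is projectively simple if it is infinite-dimensional and all its non-zero
homogeneous two-sided ideals have finite codimension. -/
def IsProjectivelySimple {K : Type*} [Field K] {A : Type*} [Ring A] [Algebra K A]
    (𝒜 : ℕ → Submodule K A) : Prop :=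
  IsAlgebraGrading 𝒜 ∧ ¬ FiniteDimensional K A ∧
    ∀ I : TwoSidedIdeal A, IsHomogeneousTwoSided 𝒜 I → I ≠ ⊥ →
      FiniteDimensional K (A ⧸ (TwoSidedIdeal.asIdeal I).restrictScalars K)

/-! ### Growth -/

/-- `f n ≥ β ^ n` for some `β > 1` and all large `n`. -/
def GrowsExponentially (f : ℕ → ℕ) : Prop :=
  ∃ β : ℝ, 1 < β ∧ ∀ᶠ n in atTop, β ^ n ≤ (f n : ℝ)

/-- `f n ≤ β ^ n` for every `β > 1` and all large `n`. -/
def GrowsSubexponentially (f : ℕ → ℕ) : Prop :=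
  ∀ β : ℝ, 1 < β → ∀ᶠ n in atTop, (f n : ℝ) ≤ β ^ n

/-- A finitely generated algebra has exponential growth if `n ↦ dim Vⁿ` grows exponentially, for
every finite-dimensional generating subspace `V` containing `1`. -/
def HasExponentialGrowth (K : Type*) [Field K] (A : Type*) [Ring A] [Algebra K A] : Prop :=
  Algebra.FiniteType K A ∧
    ∀ V : Submodule K A, V.FG → 1 ∈ V → Algebra.adjoin K (V : Set A) = ⊤ →
      GrowsExponentially fun n => Module.finrank K ↥(V ^ n)

/-- The growth function `n ↦ ∑_{i ≤ n} dim ϖⁱ/ϖⁱ⁺¹` of the graded algebra `⨁ ϖⁱ/ϖⁱ⁺¹` associated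
with an augmentation `ε`, where `ϖ = ker ε`. -/
noncomputable def augmentationGrowth {K : Type*} [Field K] {A : Type*} [Ring A] [Algebra K A]
    (ε : A →ₐ[K] K) (n : ℕ) : ℕ :=
  ∑ i ∈ Finset.range (n + 1),
    Module.finrank K
      (↥(RingHom.ker ε ^ i) ⧸ (RingHom.ker ε ^ (i + 1)).submoduleOf (RingHom.ker ε ^ i))

/-! ### Exhaustive amenability -/

/-- The span of the products `a • l` with `a ∈ V` and `l ∈ L`. -/
def smulSpan {K : Type*} [Field K] {B : Type*} [Ring B] [Algebra K B]
    {M : Type*} [AddCommGroup M] [Module K M] [Module B M]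
    (V : Submodule K B) (L : Submodule K M) : Submodule K M :=
  Submodule.span K {m | ∃ a ∈ V, ∃ l ∈ L, m = a • l}

/-- A left `B`-module `M` is exhaustively amenable if for all finite-dimensional `V ≤ B` and
`W ≤ M` and every `ε > 0` there is a finite-dimensional `L ≤ M` containing `W` such that
`dim V L < (1 + ε) dim L`. -/
def IsExhaustivelyAmenable (K : Type*) [Field K] (B : Type*) [Ring B] [Algebra K B]
    (M : Type*) [AddCommGroup M] [Module K M] [Module B M] : Prop :=
  ∀ V : Submodule K B, V.FG → ∀ ε : ℝ, 0 < ε → ∀ W : Submodule K M, W.FG →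
    ∃ L : Submodule K M, L.FG ∧ W ≤ L ∧
      (Module.finrank K (smulSpan V L) : ℝ) < (1 + ε) * (Module.finrank K L : ℝ)

/-- Every non-zero left `B`-module (in the universe `v`) is exhaustively amenable. -/
def AllLeftModulesExhaustivelyAmenable.{v, u, w} (K : Type u) [Field K] (B : Type w) [Ring B]
    [Algebra K B] : Prop :=
  ∀ (M : Type v) [AddCommGroup M] [Module K M] [Module B M] [IsScalarTower K B M] [Nontrivial M],
    IsExhaustivelyAmenable K B M

/-- Every non-zero right `A`-module, that is, left module over the opposite algebra, is
exhaustively amenable. -/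
def AllRightModulesExhaustivelyAmenable.{v, u, w} (K : Type u) [Field K] (A : Type w) [Ring A]
    [Algebra K A] : Prop :=
  AllLeftModulesExhaustivelyAmenable.{v} K Aᵐᵒᵖ

/-- Bartholdi's extension of Vershik's conjecture, over the field `K`, with the strictest notion of
amenability (so this is its weakest form): if all non-zero modules over an affine augmented algebra
are exhaustively amenable, then the graded algebra associated with the augmentation has
subexponential growth. -/
def BartholdiVershikConjecture.{u} (K : Type u) [Field K] : Prop :=
  ∀ (A : Type u) [Ring A] [Algebra K A] (ε : A →ₐ[K] K), Algebra.FiniteType K A →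
    AllRightModulesExhaustivelyAmenable.{u} K A → AllLeftModulesExhaustivelyAmenable.{u} K A →
      GrowsSubexponentially (augmentationGrowth ε)

universe v u w

/-!
The proof rests on one combinatorial property of the language `F` of a minimal subshift `X`: every
word `w` of `F` is forced by some word `u` of `F`, in the sense that `w` is the only word of its
length that can follow `u` in `F` (`IsUniformlyRecurrentLanguage.exists_forcing`). This is the
combinatorial form of the fact that a minimal map is almost injective: if every word could be
prolonged by a letter without creating an occurrence of `w`, there would be arbitrarily long words
that avoid `w`, against uniform recurrence. The property passes to the reversed language, so it
holds on both sides.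

*Amenability.* Let `u` force a word of length `N`, and let `u = w 0, w 1, …, w N` be its
prolongations. Each letter multiplies `w i` into `w (i + 1)` or `0`, so for a finite-dimensional
subspace `Q` of a module the spaces `L j = ∑_{i ≤ j} w i • Q` are mapped by letters into
`L (j + 1)`, while `dim L j` is at most linear in `j`. Hence some `L j` is almost invariant, and if
`u • M` is infinite-dimensional `Q` can be chosen so large that adding a given `W` to `L j` does not
matter. Otherwise, since every long word contains `u`, finitely generated submodules of `M` are
finite-dimensional, and they are invariant (`isExhaustivelyAmenable_of_chains`). The other side
is the same statement for the opposite algebra and the reversed language.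

*Projective simplicity.* Words that are factors of `X` form a basis of `A_X`, as the action of the
free algebra on the space with basis all words shows. If `a` is homogeneous with a non-zero
coefficient at `w` and `u` forces `w`, then `u a` is a non-zero multiple of the monomial `u w`, and
an ideal that contains a monomial contains all sufficiently long ones.

*Growth.* The space of degree `n`, which is also `ϖⁿ / ϖⁿ⁺¹`, has the number of factors of length
`n` as dimension. Positive entropy gives an exponential lower bound for this number along infinitely
many `n`, hence for all `n` by submultiplicativity.

*The counterexample.* A minimal subshift with exponentially many words is built from blocks: a block
of level `k + 1` is the concatenation of all blocks of level `k`, which gives uniform recurrence,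
followed by a large number of arbitrary blocks of level `k`, which keeps the growth rate.
-/

/-! ### Uniformly recurrent languages -/

/-- The language of a minimal subshift, axiomatized: `F` contains the empty word, is closed under
factors, every word of it can be prolonged on both sides, and every word of it occurs in all
sufficiently long words of it. -/
structure IsUniformlyRecurrentLanguage {S : Type*} (F : List S → Prop) : Prop where
  nil : F []
  of_isInfix : ∀ {v w : List S}, v <:+: w → F w → F v
  exists_concat : ∀ {w : List S}, F w → ∃ s, F (w ++ [s])
  exists_cons : ∀ {w : List S}, F w → ∃ s, F (s :: w)
  recurrent : ∀ {w : List S}, F w → ∃ R, ∀ v, F v → R ≤ v.length → w <:+: v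

/-- The words of length `n` of a language. -/
def wordsOfLength {S : Type*} (F : List S → Prop) (n : ℕ) : Set (List S) :=
  {w | F w ∧ w.length = n}

lemma finite_wordsOfLength {S : Type*} [Finite S] (F : List S → Prop) (n : ℕ) :
    (wordsOfLength F n).Finite :=
  (List.finite_length_eq S n).subset fun _ hw => hw.2

namespace IsUniformlyRecurrentLanguage

variable {S : Type*} {F : List S → Prop}

lemma reverse (hF : IsUniformlyRecurrentLanguage F) :
    IsUniformlyRecurrentLanguage fun w => F w.reverse where
  nil := hF.nil
  of_isInfix h hw := hF.of_isInfix (List.reverse_infix.2 h) hw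
  exists_concat hw := by simpa using hF.exists_cons hw
  exists_cons hw := by simpa using hF.exists_concat hw
  recurrent {w} hw := by
    obtain ⟨R, hR⟩ := hF.recurrent hw
    exact ⟨R, fun v hv hl => by
      simpa using List.reverse_infix.2 (hR _ hv (by simpa using hl))⟩

lemma exists_append (hF : IsUniformlyRecurrentLanguage F) {w : List S} (hw : F w) (n : ℕ) :
    ∃ v : List S, v.length = n ∧ F (w ++ v) := by
  induction n with
  | zero => exact ⟨[], rfl, by simpa using hw⟩
  | succ n ih =>
    obtain ⟨v, hv, hF'⟩ := ih
    obtain ⟨s, hs⟩ := hF.exists_concat hF'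
    exact ⟨v ++ [s], by simp [hv], by simpa using hs⟩

lemma exists_length_eq (hF : IsUniformlyRecurrentLanguage F) (n : ℕ) :
    ∃ w : List S, w.length = n ∧ F w := by
  simpa using hF.exists_append hF.nil n

/-- The combinatorial form of the fact that a minimal map is almost injective: otherwise every word
could be prolonged by a letter without creating an occurrence of `w` at its end, which yields
arbitrarily long words that avoid `w`. -/
lemma exists_forced_letter (hF : IsUniformlyRecurrentLanguage F) {w : List S} (hw : F w) :
    ∃ (u : List S) (a : S), F (u ++ [a]) ∧ w <:+ u ++ [a] ∧ ∀ s, F (u ++ [s]) → s = a := by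
  wlog hne : w ≠ [] generalizing w
  · obtain ⟨a, ha⟩ := hF.exists_concat hF.nil
    obtain ⟨u, b, h1, -, h3⟩ := this ha (by simp)
    rw [not_not.1 hne]
    exact ⟨u, b, h1, List.nil_suffix, h3⟩
  by_cases H : ∃ u, F u ∧ ∀ s, F (u ++ [s]) → w <:+ u ++ [s]
  · obtain ⟨u, hu, H⟩ := H
    obtain ⟨a, ha⟩ := hF.exists_concat hu
    refine ⟨u, a, ha, H a ha, fun s hs => ?_⟩
    obtain ⟨p, hp⟩ := H a ha
    obtain ⟨q, hq⟩ := H s hs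
    have h1 := congrArg List.getLast? hp
    have h2 := congrArg List.getLast? hq
    rw [List.getLast?_append_of_ne_nil _ hne] at h1 h2
    simpa using h2.symm.trans h1
  · push Not at H
    have key : ∀ n, ∃ v : List S, v.length = n ∧ F v ∧ ¬ w <:+: v := by
      intro n
      induction n with
      | zero => exact ⟨[], rfl, hF.nil, by simpa using hne⟩
      | succ n ih =>
        obtain ⟨v, hl, hv, hwv⟩ := ih
        obtain ⟨s, hs, hws⟩ := H v hv
        exact ⟨v ++ [s], by simp [hl], hs, by
          rw [List.infix_concat_iff]; tauto⟩
    obtain ⟨R, hR⟩ := hF.recurrent hw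
    obtain ⟨v, hl, hv, hwv⟩ := key R
    exact absurd (hR v hv hl.ge) hwv

/-- Every word `w` is forced by some word `u`: it is the only prolongation of `u` of its length. -/
lemma exists_forcing (hF : IsUniformlyRecurrentLanguage F) {w : List S} (hw : F w) :
    ∃ u : List S, F (u ++ w) ∧ ∀ v, v.length ≤ w.length → F (u ++ v) → v <+: w := by
  have key : ∀ k, ∃ u v : List S, v.length = k ∧ F (u ++ v) ∧ w <:+ u ++ v ∧
      ∀ v', v'.length ≤ k → F (u ++ v') → v' <+: v := by
    intro k
    induction k with
    | zero => exact ⟨w, [], rfl, by simpa using hw, by simp, fun v' h _ => by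
        rw [List.length_eq_zero_iff.1 (Nat.le_zero.1 h)]⟩
    | succ k ih =>
      obtain ⟨u, v, hl, huv, hwuv, huniq⟩ := ih
      obtain ⟨u', a, h1, ⟨p, hp⟩, h3⟩ :=
        hF.exists_forced_letter (hF.of_isInfix (List.prefix_append u v).isInfix huv)
      have hsub : ∀ t, F (u' ++ a :: t) → F (u ++ t) := fun t ht => by
        refine hF.of_isInfix (List.IsSuffix.isInfix ⟨p, ?_⟩) ht
        rw [← List.append_assoc, hp]; simp
      obtain ⟨t, htl, ht⟩ := hF.exists_append h1 k
      have htv : t = v := (huniq t htl.le (hsub t (by simpa using ht))).eq_of_length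
        (htl.trans hl.symm)
      subst htv
      refine ⟨u', a :: t, by simp [hl], by simpa using ht, hwuv.trans ⟨p, ?_⟩, ?_⟩
      · rw [← List.append_assoc, hp]; simp
      · rintro (_ | ⟨b, v'⟩) hl' hv'
        · exact List.nil_prefix
        · obtain rfl : b = a := h3 b (hF.of_isInfix (List.IsPrefix.isInfix ⟨v', by simp⟩) hv')
          exact List.cons_prefix_cons.2
            ⟨rfl, huniq v' (by simpa using hl') (hsub v' hv')⟩
  obtain ⟨u, v, hl, huv, hwuv, huniq⟩ := key w.length
  obtain rfl : w = v :=
    (List.suffix_of_suffix_length_le hwuv (List.suffix_append u v) hl.ge).eq_of_length hl.symm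
  exact ⟨u, huv, huniq⟩

/-! ### Complexity of a language -/

lemma one_le_ncard_wordsOfLength [Finite S] (hF : IsUniformlyRecurrentLanguage F) (n : ℕ) :
    1 ≤ (wordsOfLength F n).ncard := by
  obtain ⟨w, hl, hw⟩ := hF.exists_length_eq n
  exact (Set.ncard_pos (finite_wordsOfLength F n)).2 ⟨w, hw, hl⟩

lemma ncard_wordsOfLength_add_le [Finite S] (hF : IsUniformlyRecurrentLanguage F) (m n : ℕ) :
    (wordsOfLength F (m + n)).ncard ≤ (wordsOfLength F m).ncard * (wordsOfLength F n).ncard := by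
  rw [← Set.ncard_prod]
  refine Set.ncard_le_ncard_of_injOn (fun w => (w.take m, w.drop m)) ?_ ?_
    ((finite_wordsOfLength F m).prod (finite_wordsOfLength F n))
  · rintro w ⟨hw, hl⟩
    exact ⟨⟨hF.of_isInfix (List.take_prefix m w).isInfix hw, by simp [hl]⟩,
      ⟨hF.of_isInfix (List.drop_suffix m w).isInfix hw, by simp [hl]⟩⟩
  · intro w _ w' _ h
    simp only [Prod.mk.injEq] at h
    rw [← List.take_append_drop m w, h.1, h.2, List.take_append_drop]

lemma monotone_ncard_wordsOfLength [Finite S] (hF : IsUniformlyRecurrentLanguage F) :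
    Monotone fun n => (wordsOfLength F n).ncard := by
  refine monotone_nat_of_le_succ fun n => ?_
  have : Nonempty S := ⟨(hF.exists_concat hF.nil).choose⟩
  choose! f hf using fun w (hw : F w) => hF.exists_concat hw
  refine Set.ncard_le_ncard_of_injOn (fun w => w ++ [f w]) ?_ ?_ (finite_wordsOfLength F _)
  · rintro w ⟨hw, hl⟩
    exact ⟨hf w hw, by simp [hl]⟩
  · intro w _ w' _ h
    exact (List.append_inj' h rfl).1

lemma ncard_wordsOfLength_mul_le [Finite S] (hF : IsUniformlyRecurrentLanguage F) (m k : ℕ) :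
    (wordsOfLength F (m * k)).ncard ≤ (wordsOfLength F m).ncard ^ k := by
  induction k with
  | zero =>
    have : wordsOfLength F (m * 0) ⊆ {[]} := fun w hw => by
      simpa using List.length_eq_zero_iff.1 hw.2
    simpa using Set.ncard_le_ncard this
  | succ k ih =>
    rw [Nat.mul_succ, pow_succ]
    exact (hF.ncard_wordsOfLength_add_le _ _).trans (Nat.mul_le_mul_right _ ih)

/-- By submultiplicativity (as in Fekete's lemma), an exponential lower bound for the complexity
along infinitely many lengths holds for all lengths, with the same rate. -/
lemma exp_le_ncard_wordsOfLength [Finite S] (hF : IsUniformlyRecurrentLanguage F) {c : ℝ} {r : ℕ}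
    (h : ∃ᶠ n : ℕ in atTop, Real.exp (c * n) ≤ ((wordsOfLength F (n + r)).ncard : ℝ))
    {m : ℕ} (hm : 0 < m) : Real.exp (c * m) ≤ ((wordsOfLength F m).ncard : ℝ) := by
  set p : ℕ → ℕ := fun n => (wordsOfLength F n).ncard with hp
  have hp1 : ∀ n, (1 : ℝ) ≤ p n := fun n => by exact_mod_cast hF.one_le_ncard_wordsOfLength n
  have hm' : (0 : ℝ) < m := by exact_mod_cast hm
  rw [← Real.le_log_iff_exp_le (by linarith [hp1 m])]
  by_contra! hlt
  change Real.log (p m) < c * m at hlt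
  have hlog : 0 ≤ Real.log (p m) := Real.log_nonneg (hp1 m)
  -- for these `n`, `c * m * n ≤ (n + r + m) * log (p m)`, which fails for large `n`
  have hfreq : ∃ᶠ n : ℕ in atTop, c * m * n ≤ (n + r + m) * Real.log (p m) := by
    refine h.mono fun n hn => ?_
    have h1 : p (n + r) ≤ p m ^ ((n + r) / m + 1) :=
      (hF.monotone_ncard_wordsOfLength (Nat.lt_mul_div_succ (n + r) hm).le).trans
        (hF.ncard_wordsOfLength_mul_le m _)
    have h2 : Real.exp (c * n) ≤ (p m : ℝ) ^ ((n + r) / m + 1) :=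
      hn.trans (by exact_mod_cast h1)
    rw [← Real.le_log_iff_exp_le (by positivity [hp1 m]), Real.log_pow] at h2
    have h3 : (((n + r) / m : ℕ) : ℝ) * m ≤ n + r := by
      exact_mod_cast Nat.div_mul_le_self (n + r) m
    push_cast at h2
    have h4 := mul_le_mul_of_nonneg_right h2 hm'.le
    nlinarith
  have hev : ∀ᶠ n : ℕ in atTop, (n + r + m) * Real.log (p m) < c * m * n := by
    have := (tendsto_natCast_atTop_atTop (R := ℝ)).const_mul_atTop (sub_pos.2 hlt)
    filter_upwards [this.eventually_gt_atTop ((r + m) * Real.log (p m))] with n hn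
    linarith
  exact (hfreq.and_eventually hev).exists.elim fun n hn => hn.1.not_gt hn.2

end IsUniformlyRecurrentLanguage

/-! ### The language of a minimal subshift -/

/-- The word `x i, x (i + 1), …, x (i + n - 1)` read in the bi-infinite sequence `x`. -/
def window {S : Type*} (x : ℤ → S) (i : ℤ) (n : ℕ) : List S :=
  List.ofFn fun k : Fin n => x (i + (k : ℕ))

section window

variable {S : Type*}

@[simp] lemma length_window (x : ℤ → S) (i : ℤ) (n : ℕ) : (window x i n).length = n := by
  simp [window]

lemma window_add (x : ℤ → S) (i : ℤ) (m n : ℕ) :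
    window x i (m + n) = window x i m ++ window x (i + m) n := by
  simp [window, List.ofFn_add, add_assoc]

lemma window_one (x : ℤ → S) (i : ℤ) : window x i 1 = [x i] := by simp [window]

lemma window_shift (x : ℤ → S) (g i : ℤ) (n : ℕ) : window (shift g x) i n = window x (g + i) n := by
  simp [window, add_assoc]

lemma window_isInfix_window (x : ℤ → S) {i j : ℤ} {m n : ℕ} (h : j ≤ i) (h' : i + m ≤ j + n) :
    window x i m <:+: window x j n := by
  obtain ⟨a, rfl⟩ : ∃ a : ℕ, i = j + a := ⟨(i - j).toNat, by omega⟩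
  obtain ⟨b, rfl⟩ : ∃ b : ℕ, n = a + m + b := ⟨n - a - m, by omega⟩
  refine ⟨window x j a, window x (j + (a + m : ℕ)) b, ?_⟩
  rw [window_add, window_add]

lemma window_eq_iff {x y : ℤ → S} {i j : ℤ} {n : ℕ} :
    window x i n = window y j n ↔ ∀ k < n, x (i + k) = y (j + k) := by
  rw [window, window, List.ofFn_injective.eq_iff, funext_iff, Fin.forall_iff]

lemma isInfix_window_iff {x : ℤ → S} {i : ℤ} {n : ℕ} {w : List S} :
    w <:+: window x i n ↔
      ∃ j, i ≤ j ∧ j + w.length ≤ i + n ∧ w = window x j w.length := by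
  constructor
  · rintro ⟨p, q, h⟩
    have hl := congrArg List.length h
    simp only [List.length_append, length_window] at hl
    refine ⟨i + p.length, by omega, by omega, ?_⟩
    rw [← hl, window_add, window_add] at h
    exact (List.append_inj (List.append_inj h (by simp)).1 (by simp)).2
  · rintro ⟨j, h1, h2, h⟩
    rw [h]
    exact window_isInfix_window x h1 (by simpa using h2)

variable [TopologicalSpace S] [DiscreteTopology S]

lemma isClopen_window (Q : List S → Prop) (i : ℤ) (n : ℕ) :
    IsClopen {x : ℤ → S | Q (window x i n)} := by
  have hc : Continuous fun (x : ℤ → S) (k : Fin n) => x (i + (k : ℕ)) := by fun_prop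
  exact (isClopen_discrete {f : Fin n → S | Q (List.ofFn f)}).preimage hc

/-- Compactness: if arbitrarily long central words of points of `X` satisfy a property which passes
to factors, then all words of some point of `X` satisfy it. -/
lemma exists_forall_window [Finite S] {X : Set (ℤ → S)} (hX : IsClosed X) {Q : List S → Prop}
    (hQ : ∀ {v w : List S}, v <:+: w → Q w → Q v)
    (h : ∀ n : ℕ, ∃ x ∈ X, Q (window x (-n) (2 * n))) :
    ∃ x ∈ X, ∀ i n, Q (window x i n) := by
  obtain ⟨x, hx⟩ := IsCompact.nonempty_iInter_of_sequence_nonempty_isCompact_isClosed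
    (fun n : ℕ => X ∩ {x | Q (window x (-n) (2 * n))})
    (fun n x hx => ⟨hx.1, hQ (window_isInfix_window x (by omega) (by omega)) hx.2⟩)
    (fun n => h n) (hX.inter (isClopen_window Q _ _).isClosed).isCompact
    (fun n => hX.inter (isClopen_window Q _ _).isClosed)
  simp only [Set.mem_iInter] at hx
  refine ⟨x, (hx 0).1, fun i n => ?_⟩
  exact hQ (window_isInfix_window x (by omega) (by omega)) (hx (i.natAbs + n)).2

end window

section factor

variable {S : Type*} [TopologicalSpace S] {X : Subshift S ℤ}

lemma isFactor_iff {w : List S} : IsFactor X w ↔ ∃ x ∈ X.carrier, ∃ i, w = window x i w.length := by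
  unfold IsFactor
  refine exists_congr fun x => and_congr_right fun _ => exists_congr fun i => ?_
  rw [List.ext_get_iff]
  simp only [length_window, true_and]
  refine forall_congr' fun k => ⟨fun h hk _ => by simpa [window] using h hk, fun h hk => ?_⟩
  simpa [window] using h hk (by simpa using hk)

lemma isFactor_window {x : ℤ → S} (hx : x ∈ X.carrier) (i : ℤ) (n : ℕ) :
    IsFactor X (window x i n) :=
  isFactor_iff.2 ⟨x, hx, i, by simp⟩

lemma IsFactor.of_isInfix {v w : List S} (h : v <:+: w) (hw : IsFactor X w) : IsFactor X v := by
  obtain ⟨x, hx, i, hi⟩ := isFactor_iff.1 hw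
  rw [hi] at h
  obtain ⟨j, -, -, hj⟩ := isInfix_window_iff.1 h
  exact isFactor_iff.2 ⟨x, hx, j, hj⟩

lemma IsFactor.exists_eq_window {w : List S} (hw : IsFactor X w) (i : ℤ) :
    ∃ x ∈ X.carrier, w = window x i w.length := by
  obtain ⟨x, hx, j, hj⟩ := isFactor_iff.1 hw
  exact ⟨_, X.mapsTo (j - i) hx, by rw [window_shift, sub_add_cancel]; exact hj⟩

/-- The subshift of the points of `X` all of whose words satisfy `Q`. -/
def restrictSubshift [DiscreteTopology S] (X : Subshift S ℤ) (Q : List S → Prop) :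
    Subshift S ℤ where
  carrier := {x ∈ X.carrier | ∀ i n, Q (window x i n)}
  isClosed := by
    have : {x ∈ X.carrier | ∀ i n, Q (window x i n)} =
        X.carrier ∩ ⋂ i, ⋂ n, {x | Q (window x i n)} := by ext; simp
    rw [this]
    exact X.isClosed.inter (isClosed_iInter fun i => isClosed_iInter fun n =>
      (isClopen_window Q i n).isClosed)
  mapsTo g x hx := ⟨X.mapsTo g hx.1, fun i n => by rw [window_shift]; exact hx.2 _ _⟩

lemma IsMinimalSubshift.isUniformlyRecurrentLanguage [DiscreteTopology S] [Finite S]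
    (hX : IsMinimalSubshift X) : IsUniformlyRecurrentLanguage (IsFactor X) where
  nil := by
    obtain ⟨x, hx⟩ := hX.1
    exact isFactor_iff.2 ⟨x, hx, 0, by simp [window]⟩
  of_isInfix := IsFactor.of_isInfix
  exists_concat {w} hw := by
    obtain ⟨x, hx, i, hi⟩ := isFactor_iff.1 hw
    refine ⟨x (i + w.length), ?_⟩
    nth_rw 1 [hi]
    rw [← window_one, ← window_add]
    exact isFactor_window hx _ _
  exists_cons {w} hw := by
    obtain ⟨x, hx, hi⟩ := hw.exists_eq_window (0 + (1 : ℕ))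
    refine ⟨x 0, ?_⟩
    rw [hi, ← List.singleton_append, ← window_one, ← window_add]
    exact isFactor_window hx _ _
  recurrent {w} hw := by
    by_contra! H
    have hex : ∃ x ∈ X.carrier, ∀ i n, ¬ w <:+: window x i n := by
      refine exists_forall_window (Q := fun v => ¬ w <:+: v) X.isClosed
        (fun h h1 h2 => h1 (h2.trans h)) fun n => ?_
      obtain ⟨v, hv, hl, hwv⟩ := H (2 * n)
      obtain ⟨x, hx, hi⟩ := hv.exists_eq_window (-n)
      refine ⟨x, hx, fun h => hwv ?_⟩
      rw [hi]
      exact h.trans (window_isInfix_window x le_rfl (by omega))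
    have hY := hX.2 (restrictSubshift X fun v => ¬ w <:+: v) hex fun x hx => hx.1
    obtain ⟨x, hx, i, hi⟩ := isFactor_iff.1 hw
    rw [← hY] at hx
    exact hx.2 i w.length (by rw [← hi])

/-- A subshift is minimal as soon as every word read in one of its points occurs in each of its
points. -/
lemma isMinimalSubshift_of_forall_isInfix [DiscreteTopology S] (hne : X.carrier.Nonempty)
    (h : ∀ w, IsFactor X w → ∀ x ∈ X.carrier, ∃ i n, w <:+: window x i n) :
    IsMinimalSubshift X := by
  refine ⟨hne, fun Y hY hYX => hYX.antisymm fun x hx => ?_⟩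
  obtain ⟨y, hy⟩ := hY
  rw [← Y.isClosed.closure_eq, mem_closure_iff]
  intro o ho hxo
  obtain ⟨I, u, hu, huo⟩ := isOpen_pi_iff.1 ho x hxo
  obtain ⟨r, hr⟩ : ∃ r : ℕ, ∀ i ∈ I, i.natAbs ≤ r :=
    ⟨I.sup Int.natAbs, fun i hi => Finset.le_sup (f := Int.natAbs) hi⟩
  obtain ⟨i, n, hin⟩ := h _ (isFactor_window hx (-r) (2 * r + 1)) y (hYX hy)
  obtain ⟨j, -, -, hj⟩ := isInfix_window_iff.1 hin
  rw [length_window, window_eq_iff] at hj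
  refine ⟨shift (j + r) y, huo fun k hk => ?_, Y.mapsTo _ hy⟩
  have hkr := hr k hk
  have hkx : shift (j + r) y k = x k := by
    rw [shift_apply]
    convert (hj (k + r).toNat (by omega)).symm using 2 <;> omega
  rw [hkx]
  exact (hu k hk).2

end factor

/-! ### Entropy and complexity -/

/-- The minimal cardinality of a dynamical cover of a subshift is bounded by a complexity. -/
lemma coverMincard_le_ncard_wordsOfLength {S : Type*} [Finite S] [UniformSpace S]
    [DiscreteUniformity S] {X : Subshift S ℤ} (hX : X.carrier.Nonempty)
    {U : SetRel (ℤ → S) (ℤ → S)}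
    (hU : U ∈ uniformity (ℤ → S)) :
    ∃ r : ℕ, ∀ n, Dynamics.coverMincard (shift (1 : ℤ) : (ℤ → S) → (ℤ → S)) X.carrier U n ≤
      ((wordsOfLength (IsFactor X) (n + r)).ncard : ℕ∞) := by
  classical
  rw [Pi.uniformity] at hU
  simp only [DiscreteUniformity.eq_principal_setRelId, comap_principal] at hU
  obtain ⟨t, ht, htU⟩ := (hasBasis_iInf_principal_finite _).mem_iff.1 hU
  obtain ⟨r, hr⟩ : ∃ r : ℕ, ∀ i ∈ t, i.natAbs ≤ r := by
    obtain ⟨r, hr⟩ := (ht.image Int.natAbs).bddAbove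
    exact ⟨r, fun i hi => hr ⟨i, hi, rfl⟩⟩
  refine ⟨2 * r + 1, fun n => ?_⟩
  have : Nonempty (ℤ → S) := ⟨hX.some⟩
  choose! f hfX hf using fun (w : List S) (hw : IsFactor X w) => hw.exists_eq_window (-r)
  have hfin := finite_wordsOfLength (IsFactor X) (n + (2 * r + 1))
  have hcov : Dynamics.IsDynCoverOf (shift (1 : ℤ) : (ℤ → S) → (ℤ → S)) X.carrier U n
      (hfin.toFinset.image f : Finset (ℤ → S)) := by
    intro y hy
    refine ⟨f (window y (-r) (n + (2 * r + 1))), ?_, ?_⟩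
    · simp only [Finset.coe_image, Set.Finite.coe_toFinset]
      exact Set.mem_image_of_mem f ⟨isFactor_window hy _ _, by simp⟩
    · have h1 := hf _ (isFactor_window hy (-r) (n + (2 * r + 1)))
      rw [length_window, window_eq_iff] at h1
      simp only [Dynamics.dynEntourage, Set.mem_iInter, Prod.map_iterate, Set.mem_preimage]
      intro k hk
      refine htU ?_
      have hiter : ∀ (z : ℤ → S) (i : ℤ), (shift (1 : ℤ))^[k] z i = z (k + i) := by
        intro z
        clear hk
        induction k generalizing z with
        | zero => simp
        | succ k ih => intro i; rw [Function.iterate_succ_apply, ih]; simp [add_assoc, add_comm]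
      simp only [Set.mem_iInter, Set.mem_preimage, Prod.map_apply, SetRel.mem_id, hiter]
      intro i hi
      have := hr i hi
      convert h1 (k + i + r).toNat (by omega) using 2 <;> omega
  refine hcov.coverMincard_le_card.trans ?_
  rw [Set.ncard_eq_toFinset_card _ hfin]
  exact_mod_cast Finset.card_image_le

lemma exists_exp_le_ncard_wordsOfLength {S : Type*} [Finite S] [UniformSpace S]
    [DiscreteUniformity S] {X : Subshift S ℤ} (hX : IsMinimalSubshift X)
    (hent : 0 < subshiftEntropy X) :
    ∃ c : ℝ, 0 < c ∧ ∀ m : ℕ, 0 < m →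
      Real.exp (c * m) ≤ ((wordsOfLength (IsFactor X) m).ncard : ℝ) := by
  rw [subshiftEntropy, Dynamics.coverEntropy] at hent
  simp only [lt_iSup_iff] at hent
  obtain ⟨U, hU, hlt⟩ := hent
  obtain ⟨c, hc0, hc⟩ := EReal.lt_iff_exists_real_btwn.1 hlt
  obtain ⟨r, hr⟩ := coverMincard_le_ncard_wordsOfLength hX.1 hU
  refine ⟨c, by exact_mod_cast hc0, fun m hm =>
    hX.isUniformlyRecurrentLanguage.exp_le_ncard_wordsOfLength (r := r) ?_ hm⟩
  refine (ExpGrowth.frequently_exp_le hc).mono fun n hn => ?_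
  have h1 := hn.trans (ENat.toENNReal_le.2 (hr n))
  have h2 : (c : EReal) * n = ((c * n : ℝ) : EReal) := by push_cast; rfl
  rw [h2, EReal.exp_coe, ENat.toENNReal_coe, ENNReal.ofReal_le_iff_le_toReal (by simp)] at h1
  simpa using h1

/-! ### Generating subspaces -/

lemma exists_le_pow_of_adjoin_eq_top {K A : Type*} [Field K] [Ring A] [Algebra K A]
    {V : Submodule K A} (h1 : 1 ∈ V) (hV : Algebra.adjoin K (V : Set A) = ⊤)
    {W : Submodule K A} (hW : W.FG) : ∃ k, W ≤ V ^ k := by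
  have hmono : Monotone fun n => V ^ n := pow_right_mono₀ (Submodule.one_le.2 h1)
  have hex : ∀ a : A, ∃ k, a ∈ V ^ k := by
    intro a
    have ha : a ∈ Algebra.adjoin K (V : Set A) := hV ▸ Algebra.mem_top
    induction ha using Algebra.adjoin_induction with
    | mem x hx => exact ⟨1, (pow_one V).symm ▸ hx⟩
    | algebraMap r => exact ⟨0, by simp⟩
    | add x y _ _ hx hy =>
      obtain ⟨m, hm⟩ := hx
      obtain ⟨n, hn⟩ := hy
      exact ⟨max m n, add_mem (hmono (le_max_left m n) hm) (hmono (le_max_right m n) hn)⟩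
    | mul x y _ _ hx hy =>
      obtain ⟨m, hm⟩ := hx
      obtain ⟨n, hn⟩ := hy
      exact ⟨m + n, by rw [pow_add]; exact Submodule.mul_mem_mul hm hn⟩
  obtain ⟨s, rfl⟩ := hW
  choose f hf using hex
  refine ⟨s.sup f, Submodule.span_le.2 fun a ha => ?_⟩
  exact hmono (Finset.le_sup ha) (hf a)

/-! ### The span of products -/

section smulSpan

variable {K B M : Type*} [Field K] [Ring B] [Algebra K B] [AddCommGroup M] [Module K M]
  [Module B M]

lemma smul_mem_smulSpan {V : Submodule K B} {L : Submodule K M} {a : B} (ha : a ∈ V) {l : M}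
    (hl : l ∈ L) : a • l ∈ smulSpan V L :=
  Submodule.subset_span ⟨a, ha, l, hl, rfl⟩

lemma smulSpan_le {V : Submodule K B} {L P : Submodule K M} :
    smulSpan V L ≤ P ↔ ∀ a ∈ V, ∀ l ∈ L, a • l ∈ P := by
  rw [smulSpan, Submodule.span_le]
  exact ⟨fun h a ha l hl => h ⟨a, ha, l, hl, rfl⟩, by
    rintro h _ ⟨a, ha, l, hl, rfl⟩; exact h a ha l hl⟩

variable [IsScalarTower K B M]

lemma smulSpan_eq_map₂ (V : Submodule K B) (L : Submodule K M) :
    smulSpan V L = Submodule.map₂ (Algebra.lsmul K K M).toLinearMap V L := by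
  refine le_antisymm (smulSpan_le.2 fun a ha l hl => ?_) (Submodule.map₂_le.2 fun a ha l hl => ?_)
  · exact Submodule.apply_mem_map₂ (Algebra.lsmul K K M).toLinearMap ha hl
  · exact smul_mem_smulSpan ha hl

lemma fg_smulSpan {V : Submodule K B} {L : Submodule K M} (hV : V.FG) (hL : L.FG) :
    (smulSpan V L).FG := by
  rw [smulSpan_eq_map₂]; exact hV.map₂ _ hL

/-- The subspace `a • Q` of the module `M`. -/
def smulImage (a : B) (Q : Submodule K M) : Submodule K M :=
  Q.map (Algebra.lsmul K K M a)

lemma smul_mem_pow_of_forall_mem {G : Submodule K B} {L : ℕ → Submodule K M} {N : ℕ}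
    (h : ∀ j < N, ∀ a ∈ G, ∀ l ∈ L j, a • l ∈ L (j + 1)) {j d : ℕ} (hjd : j + d ≤ N) :
    ∀ a ∈ G ^ d, ∀ l ∈ L j, a • l ∈ L (j + d) := by
  induction d with
  | zero =>
    intro a ha l hl
    rw [pow_zero, Submodule.mem_one] at ha
    obtain ⟨r, rfl⟩ := ha
    simpa [algebraMap_smul] using (L j).smul_mem r hl
  | succ d ih =>
    intro a ha l hl
    rw [pow_succ'] at ha
    induction ha using Submodule.mul_induction_on' with
    | mem_mul_mem x hx y hy =>
      rw [mul_smul]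
      exact h (j + d) (by omega) x hx _ (ih (by omega) y hy l hl)
    | add x _ y _ hx hy => rw [add_smul]; exact add_mem hx hy

/-! ### Amenability -/

lemma exists_submodule_smulImage_finrank_eq (u : B)
    (hu : ¬ (smulImage u (⊤ : Submodule K M)).FG) (q : ℕ) :
    ∃ Q : Submodule K M, Q.FG ∧ Module.finrank K Q ≤ q ∧
      Module.finrank K (smulImage u Q) = q := by
  have hinf : ¬ Module.Finite K (smulImage u (⊤ : Submodule K M)) := fun h =>
    hu (Module.Finite.iff_fg.1 h)
  have hrank : (q : Cardinal) ≤ Module.rank K (smulImage u (⊤ : Submodule K M)) := by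
    rw [← Module.rank_lt_aleph0_iff, not_lt] at hinf
    exact (Cardinal.natCast_lt_aleph0).le.trans hinf
  obtain ⟨f, hf⟩ := exists_linearIndependent_of_le_rank hrank
  choose p hp using fun i => (f i).2
  have hf' : LinearIndependent K fun i => (f i : M) :=
    hf.map' (Submodule.subtype _) (Submodule.ker_subtype _)
  have hmap : smulImage u (Submodule.span K (Set.range p)) =
      Submodule.span K (Set.range fun i => (f i : M)) := by
    rw [smulImage, Submodule.map_span, ← Set.range_comp]
    congr 2
    exact funext fun i => (hp i).2
  refine ⟨Submodule.span K (Set.range p), Submodule.fg_span (Set.finite_range p), ?_, ?_⟩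
  · exact (finrank_range_le_card (R := K) p).trans_eq (Fintype.card_fin q)
  · rw [hmap, finrank_span_eq_card hf', Fintype.card_fin]

/-- A sequence bounded by a linear function does not grow exponentially along the multiples of `d`;
the number `t` of steps needed to see this depends neither on the sequence nor on its first
value. -/
lemma exists_lt_mul_of_le_linear {d : ℕ} {δ : ℝ} (hδ : 0 < δ) :
    ∃ t : ℕ, ∀ (a : ℕ → ℕ) (q : ℕ), 0 < q → a 0 = q → (∀ j, a j ≤ (j + 1) * q) →
      ∃ s < t, (a (d * (s + 1)) : ℝ) < (1 + δ) * a (d * s) := by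
  obtain ⟨t, ht⟩ : ∃ t : ℕ, ((d * t + 1 : ℕ) : ℝ) < (1 + δ) ^ t := by
    have hδ1 : 1 < 1 + δ := by linarith
    have h1 := (tendsto_pow_const_div_const_pow_of_one_lt 1 hδ1).const_mul (d : ℝ)
    have h2 := tendsto_pow_const_div_const_pow_of_one_lt 0 hδ1
    have h3 := h1.add h2
    simp only [mul_zero, add_zero] at h3
    obtain ⟨t, ht⟩ := (h3.eventually_lt_const one_pos).exists
    refine ⟨t, ?_⟩
    have hpos : (0 : ℝ) < (1 + δ) ^ t := by positivity
    rw [← mul_div_assoc, ← add_div, div_lt_one hpos] at ht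
    simpa using ht
  refine ⟨t, fun a q hq h0 ha => ?_⟩
  by_contra! H
  have key : ∀ s ≤ t, (1 + δ) ^ s * q ≤ (a (d * s) : ℝ) := by
    intro s
    induction s with
    | zero => simp [h0]
    | succ s ih =>
      intro hs
      have := ih (by omega)
      calc (1 + δ) ^ (s + 1) * q = (1 + δ) * ((1 + δ) ^ s * q) := by ring
        _ ≤ (1 + δ) * a (d * s) := by gcongr
        _ ≤ _ := H s (by omega)
  have h1 := key t le_rfl
  have h2 : (a (d * t) : ℝ) ≤ ((d * t + 1 : ℕ) : ℝ) * q := by exact_mod_cast ha _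
  have hq' : (0 : ℝ) < q := by exact_mod_cast hq
  nlinarith

/-- Suppose that `B` has, for each `N`, a chain `u = w 0, w 1, …, w N` such that each generator
sends `w i` to `w (i + 1)` or to `0`, where moreover the two-sided ideal generated by `u` has finite
codimension in the strong sense that `B = F + F u B` for a finite-dimensional `F`. Then every
non-zero `B`-module is exhaustively amenable. If `u • M` is infinite-dimensional, the subspaces
`∑_{i ≤ j} w i • Q`, with `Q` large, have dimension at most linear in `j`, hence one of them is
almost invariant; otherwise all finitely generated submodules of `M` are finite-dimensional. -/
theorem isExhaustivelyAmenable_of_chains {S : Type*} [Finite S] [Nontrivial M] (g : S → B)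
    (hg : Algebra.adjoin K (Set.range g) = ⊤)
    (h : ∀ N : ℕ, ∃ w : ℕ → B, (∀ i < N, ∀ s, g s * w i = 0 ∨ g s * w i = w (i + 1)) ∧
      ∃ F : Submodule K B, F.FG ∧ ⊤ ≤ F ⊔ F * (K ∙ w 0) * ⊤) :
    IsExhaustivelyAmenable K B M := by
  intro V hV ε hε W hW
  set G : Submodule K B := 1 ⊔ Submodule.span K (Set.range g) with hG
  have hG1 : 1 ∈ G := (le_sup_left : 1 ≤ G) (Submodule.one_le.1 le_rfl)
  have hGgen : Algebra.adjoin K (G : Set B) = ⊤ := by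
    rw [eq_top_iff, ← hg]
    exact Algebra.adjoin_mono fun a ha =>
      (le_sup_right : _ ≤ G) (Submodule.subset_span ha)
  have hGfg : G.FG := (Submodule.FG.pow (Submodule.fg_bot (R := K) (M := B)) 0).sup
    (Submodule.fg_span (Set.finite_range g))
  obtain ⟨d, hd⟩ := exists_le_pow_of_adjoin_eq_top hG1 hGgen hV
  obtain ⟨t, ht⟩ := exists_lt_mul_of_le_linear (d := d) (half_pos hε)
  obtain ⟨w, hw, F, hF, hFtop⟩ := h (d * t)
  by_cases hu : (smulImage (w 0) (⊤ : Submodule K M)).FG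
  -- `W` is enlarged so that the finite-dimensional submodule it generates is not zero
  · obtain ⟨m, hm⟩ := exists_ne (0 : M)
    set W' : Submodule K M := W ⊔ K ∙ m
    have hW' : W'.FG := hW.sup (Submodule.fg_span_singleton m)
    set L : Submodule K M := smulSpan (⊤ : Submodule K B) W'
    have hWL : W' ≤ L := fun x hx => by
      simpa using smul_mem_smulSpan (V := (⊤ : Submodule K B)) (Submodule.mem_top (x := 1)) hx
    have hLle : L ≤ smulSpan F W' ⊔ smulSpan F (smulImage (w 0) (⊤ : Submodule K M)) := by
      refine smulSpan_le.2 fun a _ l hl => ?_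
      obtain ⟨b, hb, c, hc, rfl⟩ := Submodule.mem_sup.1 (hFtop (Submodule.mem_top (x := a)))
      rw [add_smul]
      refine Submodule.add_mem_sup (smul_mem_smulSpan hb hl) ?_
      clear * - hc
      induction hc using Submodule.mul_induction_on' with
      | mem_mul_mem x hx y _ =>
        induction hx using Submodule.mul_induction_on' with
        | mem_mul_mem x hx z hz =>
          obtain ⟨r, rfl⟩ := Submodule.mem_span_singleton.1 hz
          rw [mul_smul, mul_smul]
          refine smul_mem_smulSpan hx ?_
          rw [smul_assoc]
          exact Submodule.smul_mem _ _ ⟨y • l, trivial, rfl⟩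
        | add x _ z _ hx hz => rw [add_mul, add_smul]; exact add_mem hx hz
      | add x _ y _ hx hy => rw [add_smul]; exact add_mem hx hy
    have hLfg : L.FG := Submodule.FG.of_le ((fg_smulSpan hF hW').sup (fg_smulSpan hF hu)) hLle
    have hVL : smulSpan V L ≤ L := by
      refine smulSpan_le.2 fun a _ l hl => ?_
      induction hl using Submodule.span_induction with
      | mem x hx =>
        obtain ⟨b, -, l, hl, rfl⟩ := hx
        rw [← mul_smul]
        exact smul_mem_smulSpan Submodule.mem_top hl
      | zero => simp
      | add x y _ _ hx hy => rw [smul_add]; exact add_mem hx hy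
      | smul r x _ hx =>
        rw [← algebraMap_smul B r x, ← mul_smul, ← Algebra.commutes, mul_smul, algebraMap_smul]
        exact L.smul_mem r hx
    have : Module.Finite K L := Module.Finite.iff_fg.2 hLfg
    have hpos : 0 < Module.finrank K L := by
      have : m ∈ L := hWL ((le_sup_right : _ ≤ W') (Submodule.mem_span_singleton_self m))
      exact Submodule.one_le_finrank_iff.2 fun h => hm (by simpa [h] using this)
    refine ⟨L, hLfg, le_sup_left.trans hWL, ?_⟩
    have h1 : (Module.finrank K (smulSpan V L) : ℝ) ≤ Module.finrank K L := by
      exact_mod_cast Submodule.finrank_mono hVL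
    have h2 : (0 : ℝ) < Module.finrank K L := by exact_mod_cast hpos
    nlinarith
  -- `q > 2 C / ε` makes the contribution `C` of `W` negligible with respect to `dim L j ≥ q`
  · set C := Module.finrank K (smulSpan (G ^ d) W)
    obtain ⟨q, hq⟩ := exists_nat_gt (C / (ε / 2))
    have hq0 : 0 < q := by
      have : (0 : ℝ) ≤ C / (ε / 2) := by positivity
      exact_mod_cast this.trans_lt hq
    obtain ⟨Q, hQ, hQq, huQ⟩ := exists_submodule_smulImage_finrank_eq (w 0) hu q
    have : Module.Finite K Q := Module.Finite.iff_fg.2 hQ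
    set L : ℕ → Submodule K M := fun j => ⨆ i ∈ Finset.range (j + 1), smulImage (w i) Q with hL
    have hLsucc : ∀ j, L (j + 1) = smulImage (w (j + 1)) Q ⊔ L j := fun j => by
      simp only [hL]
      rw [Finset.range_add_one, Finset.iSup_insert]
    have hL0 : L 0 = smulImage (w 0) Q := by simp [hL]
    have hLfg : ∀ j, (L j).FG := fun j => Submodule.fg_biSup _ _ fun i _ => hQ.map _
    have hLfin : ∀ j, Module.Finite K (L j) := fun j => Module.Finite.iff_fg.2 (hLfg j)
    have hLdim : ∀ j, Module.finrank K (L j) ≤ (j + 1) * q := by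
      intro j
      induction j with
      | zero => rw [hL0, huQ]; simp
      | succ j ih =>
        rw [hLsucc]
        have : Module.Finite K (smulImage (w (j + 1)) Q) := Module.Finite.iff_fg.2 (hQ.map _)
        have h1 := Submodule.finrank_add_le_finrank_add_finrank (smulImage (w (j + 1)) Q) (L j)
        have h2 : Module.finrank K (smulImage (w (j + 1)) Q) ≤ Module.finrank K Q :=
          Submodule.finrank_map_le _ _
        calc _ ≤ _ := h1
          _ ≤ q + (j + 1) * q := by omega
          _ = _ := by ring
    have hLstep : ∀ j < d * t, ∀ a ∈ G, ∀ l ∈ L j, a • l ∈ L (j + 1) := by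
      intro j hj a ha l hl
      have hsub : ∀ i ≤ j + 1, smulImage (w i) Q ≤ L (j + 1) := fun i hi =>
        le_biSup (fun i => smulImage (w i) Q) (by simpa using by omega)
      have hjj : L j ≤ L (j + 1) := by rw [hLsucc]; exact le_sup_right
      obtain ⟨r, hr, b, hb, rfl⟩ := Submodule.mem_sup.1 ha
      rw [add_smul]
      refine add_mem ?_ ?_
      · obtain ⟨k, rfl⟩ := Submodule.mem_one.1 hr
        rw [algebraMap_smul]
        exact (L (j + 1)).smul_mem k (hjj hl)
      · have hmul : ∀ s, L j ≤ (L (j + 1)).comap (Algebra.lsmul K K M (g s)) := by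
          intro s
          refine iSup₂_le fun i hi => ?_
          rintro _ ⟨x, hx, rfl⟩
          have hi' : i ≤ j := by simpa [Nat.lt_succ_iff] using hi
          change g s • w i • x ∈ L (j + 1)
          rw [← mul_smul]
          rcases hw i (by omega) s with h0 | h0 <;> rw [h0]
          · simp
          · exact hsub (i + 1) (by omega) ⟨x, hx, rfl⟩
        clear ha hr
        induction hb using Submodule.span_induction with
        | mem x hx => obtain ⟨s, rfl⟩ := hx; exact hmul s hl
        | zero => simp
        | add x y _ _ hx hy => rw [add_smul]; exact add_mem hx hy
        | smul r x _ hx => rw [smul_assoc]; exact Submodule.smul_mem _ r hx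
    obtain ⟨s, hst, hs⟩ := ht (fun j => Module.finrank K (L j)) q hq0 (by rw [hL0, huQ]) hLdim
    have hds : d * s + d ≤ d * t := by
      rw [← Nat.mul_succ]; exact Nat.mul_le_mul_left _ hst
    refine ⟨W ⊔ L (d * s), hW.sup (hLfg _), le_sup_left, ?_⟩
    have hle : smulSpan V (W ⊔ L (d * s)) ≤ smulSpan (G ^ d) W ⊔ L (d * (s + 1)) := by
      refine smulSpan_le.2 fun a ha l hl => ?_
      obtain ⟨x, hx, y, hy, rfl⟩ := Submodule.mem_sup.1 hl
      rw [smul_add]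
      exact Submodule.add_mem_sup (smul_mem_smulSpan (hd ha) hx)
        (smul_mem_pow_of_forall_mem hLstep hds a (hd ha) y hy)
    have hfg1 : (smulSpan (G ^ d) W).FG := fg_smulSpan (hGfg.pow d) hW
    have : Module.Finite K (smulSpan (G ^ d) W) := Module.Finite.iff_fg.2 hfg1
    have : Module.Finite K W := Module.Finite.iff_fg.2 hW
    have h1 : (Module.finrank K (smulSpan V (W ⊔ L (d * s))) : ℝ) ≤
        C + Module.finrank K (L (d * (s + 1))) := by
      exact_mod_cast (Submodule.finrank_mono hle).trans
        (Submodule.finrank_add_le_finrank_add_finrank _ _)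
    have hmono : L 0 ≤ L (d * s) :=
      biSup_mono fun i hi => by simp at hi ⊢; omega
    have h2 : (q : ℝ) ≤ Module.finrank K (L (d * s)) := by
      rw [← huQ, ← hL0]; exact_mod_cast Submodule.finrank_mono hmono
    have h3 : (Module.finrank K (L (d * s)) : ℝ) ≤ Module.finrank K ↥(W ⊔ L (d * s)) := by
      exact_mod_cast Submodule.finrank_mono le_sup_right
    rw [div_lt_iff₀ (half_pos hε)] at hq
    nlinarith

end smulSpan

/-! ### Modules over monomial algebras -/

/-- A `K`-algebra spanned by the values of a multiplicative map on words which vanishes outside a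
language `F`. -/
structure IsMonomialMap {S : Type*} (K : Type*) {B : Type*} [Field K] [Ring B] [Algebra K B]
    (F : List S → Prop) (mon : List S → B) : Prop where
  nil : mon [] = 1
  append : ∀ v w, mon (v ++ w) = mon v * mon w
  eq_zero : ∀ w, ¬ F w → mon w = 0
  span_range : Submodule.span K (Set.range mon) = ⊤

namespace IsMonomialMap

variable {S K B : Type*} [Field K] [Ring B] [Algebra K B] {F : List S → Prop} {mon : List S → B}

lemma cons (h : IsMonomialMap K F mon) (s : S) (w : List S) : mon (s :: w) = mon [s] * mon w :=
  h.append [s] w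

lemma op (h : IsMonomialMap K F mon) :
    IsMonomialMap K (fun w => F w.reverse) fun w => MulOpposite.op (mon w.reverse) where
  nil := by simp [h.nil]
  append v w := by simp [h.append]
  eq_zero w hw := by simp [h.eq_zero _ hw]
  span_range := by
    have : Set.range (fun w : List S => MulOpposite.op (mon w.reverse)) =
        (MulOpposite.opLinearEquiv K : B ≃ₗ[K] Bᵐᵒᵖ) '' Set.range mon := by
      rw [← Set.range_comp, ← List.reverse_surjective.range_comp]
      congr 1
      funext w
      simp
    rw [this, ← LinearEquiv.coe_coe, ← Submodule.map_span, h.span_range, Submodule.map_top,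
      LinearEquiv.range]

lemma adjoin_range (h : IsMonomialMap K F mon) :
    Algebra.adjoin K (Set.range fun s : S => mon [s]) = ⊤ := by
  have key : ∀ w, mon w ∈ Algebra.adjoin K (Set.range fun s : S => mon [s]) := by
    intro w
    induction w with
    | nil => rw [h.nil]; exact one_mem _
    | cons s w ih =>
      rw [h.cons]
      exact mul_mem (Algebra.subset_adjoin ⟨s, rfl⟩) ih
  rw [← Algebra.toSubmodule_eq_top, eq_top_iff, ← h.span_range, Submodule.span_le]
  rintro _ ⟨w, rfl⟩
  exact key w

lemma exists_fg_top_le (h : IsMonomialMap K F mon) [Finite S]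
    (hF : IsUniformlyRecurrentLanguage F) {z : List S} (hz : F z) :
    ∃ P : Submodule K B, P.FG ∧ ⊤ ≤ P ⊔ P * (K ∙ mon z) * ⊤ := by
  obtain ⟨R, hR⟩ := hF.recurrent hz
  refine ⟨Submodule.span K (mon '' {w | w.length ≤ R}),
    Submodule.fg_span ((List.finite_length_le S R).image _), ?_⟩
  rw [← h.span_range, Submodule.span_le]
  rintro _ ⟨w, rfl⟩
  by_cases hw : F w
  · by_cases hl : w.length ≤ R
    · exact Submodule.mem_sup_left (Submodule.subset_span ⟨w, hl, rfl⟩)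
    · obtain ⟨p, q, hpq⟩ := hR (w.take R) (hF.of_isInfix (List.take_prefix R w).isInfix hw)
        (by simp; omega)
      have hlen := congrArg List.length hpq
      simp at hlen
      refine Submodule.mem_sup_right ?_
      rw [← List.take_append_drop R w, ← hpq, List.append_assoc (p ++ z), h.append, h.append]
      exact Submodule.mul_mem_mul (Submodule.mul_mem_mul
        (Submodule.subset_span ⟨p, by simp; omega, rfl⟩)
        (Submodule.mem_span_singleton_self _)) (Submodule.subset_span ⟨_, rfl⟩)
  · rw [h.eq_zero w hw]; exact zero_mem _

/-- The chains are provided by the words which force, to their left, a prescribed word. -/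
lemma isExhaustivelyAmenable (h : IsMonomialMap K F mon) [Finite S]
    (hF : IsUniformlyRecurrentLanguage F) (M : Type*) [AddCommGroup M] [Module K M] [Module B M]
    [IsScalarTower K B M] [Nontrivial M] : IsExhaustivelyAmenable K B M := by
  refine isExhaustivelyAmenable_of_chains (fun s => mon [s]) h.adjoin_range fun N => ?_
  obtain ⟨v, hvl, hv⟩ := hF.reverse.exists_length_eq N
  obtain ⟨u, huv, huniq⟩ := hF.reverse.exists_forcing hv
  refine ⟨fun i => mon (u ++ v.take i).reverse, fun i hi s => ?_, ?_⟩
  · have heq : mon [s] * mon (u ++ v.take i).reverse = mon (u ++ (v.take i ++ [s])).reverse := by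
      rw [← h.append]; simp
    rw [heq]
    by_cases hs : F (u ++ (v.take i ++ [s])).reverse
    · right
      have hpre := huniq (v.take i ++ [s]) (by simp; omega) hs
      have := List.prefix_iff_eq_take.1 hpre
      rw [this]
      congr 4
      simp; omega
    · exact Or.inl (h.eq_zero _ hs)
  · exact h.exists_fg_top_le hF
      (hF.reverse.of_isInfix (List.IsPrefix.isInfix (by simp)) huv)

end IsMonomialMap

/-! ### The monomial basis of the algebra of a subshift -/

namespace SubshiftAlgebra

variable {K : Type*} [Field K] {S : Type*} [TopologicalSpace S] {X : Subshift S ℤ}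

lemma monomial_append (v w : List S) :
    monomial K X (v ++ w) = monomial K X v * monomial K X w := by
  simp [monomial, freeMonomial]

lemma monomial_eq_zero {w : List S} (hw : ¬ IsFactor X w) : monomial K X w = 0 := by
  simpa [monomial] using RingQuot.mkAlgHom_rel K (SubshiftRel.of_not_factor (K := K) w hw)

lemma span_range_monomial : Submodule.span K (Set.range (monomial K X)) = ⊤ := by
  have key : ∀ a : FreeAlgebra K S, RingQuot.mkAlgHom K (SubshiftRel K X) a ∈
      Submodule.span K (Set.range (monomial K X)) := by
    intro a
    induction a using FreeAlgebra.induction with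
    | grade0 r =>
      rw [AlgHom.commutes, Algebra.algebraMap_eq_smul_one]
      exact Submodule.smul_mem _ _ (Submodule.subset_span ⟨[], by simp [monomial, freeMonomial]⟩)
    | grade1 s => exact Submodule.subset_span ⟨[s], by simp [monomial, freeMonomial]⟩
    | mul a b ha hb =>
      rw [map_mul]
      have := Submodule.mul_mem_mul ha hb
      rw [Submodule.span_mul_span] at this
      refine Submodule.span_mono ?_ this
      rintro _ ⟨_, ⟨v, rfl⟩, _, ⟨w, rfl⟩, rfl⟩
      exact ⟨v ++ w, monomial_append v w⟩
    | add a b ha hb => rw [map_add]; exact add_mem ha hb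
  rw [eq_top_iff]
  rintro a -
  obtain ⟨b, rfl⟩ := RingQuot.mkAlgHom_surjective K (SubshiftRel K X) a
  exact key b

lemma isMonomialMap : IsMonomialMap K (IsFactor X) (monomial K X) where
  nil := by simp [monomial, freeMonomial]
  append := monomial_append
  eq_zero _ := monomial_eq_zero
  span_range := span_range_monomial

open Classical in
/-- The operator `w ↦ s w` on the space with basis the words, where `s w` is replaced by `0` if it
is not a factor of `X`. -/
noncomputable def consOperator (K : Type*) [Field K] (X : Subshift S ℤ) (s : S) :
    Module.End K (List S →₀ K) :=
  Finsupp.lsum K fun w => if IsFactor X (s :: w) then Finsupp.lsingle (s :: w) else 0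

open Classical in
lemma lift_consOperator_freeMonomial {w : List S} (hw : w ≠ []) (v : List S) :
    FreeAlgebra.lift K (consOperator K X) (freeMonomial K w) (Finsupp.single v 1) =
      if IsFactor X (w ++ v) then Finsupp.single (w ++ v) 1 else 0 := by
  induction w with
  | nil => exact absurd rfl hw
  | cons s w ih =>
    have hcons : freeMonomial K (s :: w) = FreeAlgebra.ι K s * freeMonomial K w := by
      simp [freeMonomial]
    have hop : ∀ t : List S, consOperator K X s (Finsupp.single t 1) =
        if IsFactor X (s :: t) then Finsupp.single (s :: t) 1 else 0 := fun t => by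
      rw [consOperator, Finsupp.lsum_single]
      split_ifs <;> simp
    rw [hcons, map_mul, Module.End.mul_apply, FreeAlgebra.lift_ι_apply]
    rcases eq_or_ne w [] with rfl | hne
    · simpa [freeMonomial] using hop v
    · rw [ih hne]
      by_cases h1 : IsFactor X (w ++ v)
      · rw [if_pos h1, hop]; rfl
      · rw [if_neg h1, map_zero, if_neg]
        exact fun h2 => h1 (h2.of_isInfix ⟨[s], [], by simp⟩)

/-- The representation of `A_X` on the space with basis the words, by left multiplication. -/
noncomputable def rep (K : Type*) [Field K] (hX : IsFactor X []) :
    SubshiftAlgebra K X →ₐ[K] Module.End K (List S →₀ K) :=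
  RingQuot.liftAlgHom K ⟨FreeAlgebra.lift K (consOperator K X), by
    rintro _ _ ⟨w, hw⟩
    refine Finsupp.lhom_ext' fun v => LinearMap.ext_ring ?_
    rw [map_zero, LinearMap.comp_apply, Finsupp.lsingle_apply, lift_consOperator_freeMonomial]
    · rw [if_neg fun h => hw (h.of_isInfix ⟨[], v, by simp⟩)]; rfl
    · rintro rfl; exact hw hX⟩

/-- The coordinates of an element of `A_X` in the basis of monomials. -/
noncomputable def coords (K : Type*) [Field K] (hX : IsFactor X []) :
    SubshiftAlgebra K X →ₗ[K] (List S →₀ K) :=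
  (LinearMap.applyₗ (Finsupp.single [] 1)).comp (rep K hX).toLinearMap

open Classical in
lemma coords_monomial (hX : IsFactor X []) (w : List S) :
    coords K hX (monomial K X w) = if IsFactor X w then Finsupp.single w 1 else 0 := by
  have : coords K hX (monomial K X w) =
      FreeAlgebra.lift K (consOperator K X) (freeMonomial K w) (Finsupp.single [] 1) := by
    simp [coords, rep, monomial]
  rw [this]
  rcases eq_or_ne w [] with rfl | hne
  · simp [freeMonomial, hX]
  · simpa using lift_consOperator_freeMonomial (K := K) (X := X) hne []

lemma linearCombination_coords (hX : IsFactor X []) (a : SubshiftAlgebra K X) :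
    Finsupp.linearCombination K (monomial K X) (coords K hX a) = a := by
  classical
  have ha : a ∈ Submodule.span K (Set.range (monomial K X)) :=
    span_range_monomial (K := K) (X := X) ▸ Submodule.mem_top
  induction ha using Submodule.span_induction with
  | mem x hx =>
    obtain ⟨w, rfl⟩ := hx
    rw [coords_monomial]
    split_ifs with h
    · simp
    · rw [map_zero, monomial_eq_zero h]
  | zero => simp
  | add x y _ _ hx hy => rw [map_add, map_add, hx, hy]
  | smul r x _ hx => rw [map_smul, map_smul, hx]

lemma coords_injective (hX : IsFactor X []) : Function.Injective (coords K hX) :=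
  Function.LeftInverse.injective (linearCombination_coords hX)

lemma linearIndependent_monomial (hX : IsFactor X []) :
    LinearIndependent K fun w : {w // IsFactor X w} => monomial K X w := by
  classical
  refine LinearIndependent.of_comp (coords K hX) ?_
  have : (coords K hX ∘ fun w : {w // IsFactor X w} => monomial K X w) =
      (fun w : List S => Finsupp.single w (1 : K)) ∘ Subtype.val := by
    funext w
    simp [coords_monomial, w.2]
  rw [this]
  exact (Finsupp.linearIndependent_single_one K (List S)).comp _ Subtype.val_injective

/-! ### The grading -/

/-- The span of the monomials attached to a set of words. -/
def wordSpan (K : Type*) [Field K] (X : Subshift S ℤ) (T : Set (List S)) :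
    Submodule K (SubshiftAlgebra K X) :=
  Submodule.span K (monomial K X '' T)

lemma wordSpan_mono {T T' : Set (List S)} (h : T ⊆ T') : wordSpan K X T ≤ wordSpan K X T' :=
  Submodule.span_mono (Set.image_mono h)

lemma monomial_mem_wordSpan {T : Set (List S)} {w : List S} (hw : w ∈ T) :
    monomial K X w ∈ wordSpan K X T :=
  Submodule.subset_span ⟨w, hw, rfl⟩

lemma wordSpan_union (T T' : Set (List S)) :
    wordSpan K X (T ∪ T') = wordSpan K X T ⊔ wordSpan K X T' := by
  rw [wordSpan, Set.image_union, Submodule.span_union]; rfl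

lemma wordSpan_univ : wordSpan K X Set.univ = ⊤ := by
  rw [wordSpan, Set.image_univ, span_range_monomial]

lemma component_eq_wordSpan (n : ℕ) : component K X n = wordSpan K X {w | w.length = n} := by
  rw [component, wordSpan]
  congr 1
  ext a
  simp [eq_comm]

lemma mul_mem_wordSpan {T T' T'' : Set (List S)} (h : ∀ v ∈ T, ∀ w ∈ T', v ++ w ∈ T'')
    {a b : SubshiftAlgebra K X} (ha : a ∈ wordSpan K X T) (hb : b ∈ wordSpan K X T') :
    a * b ∈ wordSpan K X T'' := by
  have := Submodule.mul_mem_mul ha hb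
  rw [wordSpan, wordSpan, Submodule.span_mul_span] at this
  refine Submodule.span_mono ?_ this
  rintro _ ⟨_, ⟨v, hv, rfl⟩, _, ⟨w, hw, rfl⟩, rfl⟩
  exact ⟨v ++ w, h v hv w hw, monomial_append v w⟩

lemma mem_of_coords_ne_zero (hX : IsFactor X []) {T : Set (List S)} {a : SubshiftAlgebra K X}
    (ha : a ∈ wordSpan K X T) {w : List S} (hw : coords K hX a w ≠ 0) : IsFactor X w ∧ w ∈ T := by
  classical
  contrapose! hw
  induction ha using Submodule.span_induction with
  | mem x hx =>
    obtain ⟨v, hv, rfl⟩ := hx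
    rw [coords_monomial]
    split_ifs with h
    · rw [Finsupp.single_apply, if_neg]
      rintro rfl
      exact hw h hv
    · rfl
  | zero => simp
  | add x y _ _ hx hy => simp [hx, hy]
  | smul r x _ hx => simp [hx]

lemma disjoint_wordSpan (hX : IsFactor X []) {T T' : Set (List S)} (h : Disjoint T T') :
    Disjoint (wordSpan K X T) (wordSpan K X T') := by
  rw [Submodule.disjoint_def]
  intro a ha ha'
  refine coords_injective hX ?_
  rw [map_zero]
  ext w
  by_contra hne
  exact Set.disjoint_left.1 h (mem_of_coords_ne_zero hX ha hne).2
    (mem_of_coords_ne_zero hX ha' hne).2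

lemma fg_wordSpan {T : Set (List S)} (hT : T.Finite) : (wordSpan K X T).FG :=
  Submodule.fg_span (hT.image _)

lemma fg_component [Finite S] (n : ℕ) : (component K X n).FG := by
  rw [component_eq_wordSpan]
  exact fg_wordSpan (List.finite_length_eq S n)

lemma finrank_component [Finite S] (hX : IsFactor X []) (n : ℕ) :
    Module.finrank K (component K X n) = (wordsOfLength (IsFactor X) n).ncard := by
  have hfin := finite_wordsOfLength (IsFactor X) n
  have : Fintype (wordsOfLength (IsFactor X) n) := hfin.fintype
  have hli : LinearIndependent K fun w : wordsOfLength (IsFactor X) n => monomial K X w :=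
    (linearIndependent_monomial hX).comp
      (fun w : wordsOfLength (IsFactor X) n => ⟨w.1, w.2.1⟩) fun v w h => by
        simpa [Subtype.ext_iff] using h
  have hspan : component K X n =
      Submodule.span K (Set.range fun w : wordsOfLength (IsFactor X) n => monomial K X w) := by
    refine le_antisymm (Submodule.span_le.2 ?_) (Submodule.span_mono ?_)
    · rintro _ ⟨w, hl, rfl⟩
      by_cases hw : IsFactor X w
      · exact Submodule.subset_span ⟨⟨w, hw, hl⟩, rfl⟩
      · rw [monomial_eq_zero hw]; exact zero_mem _
    · rintro _ ⟨w, rfl⟩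
      exact ⟨w, w.2.2, rfl⟩
  rw [hspan, finrank_span_eq_card hli, Set.ncard_eq_toFinset_card', Set.toFinset_card]

lemma isAlgebraGrading (hX : IsFactor X []) : IsAlgebraGrading (component K X) := by
  refine ⟨{ one_mem := ?_, mul_mem := ?_ }, ?_⟩
  · rw [← isMonomialMap.nil (K := K) (F := IsFactor X), component_eq_wordSpan]
    exact monomial_mem_wordSpan (by simp)
  · intro i j a b ha hb
    rw [component_eq_wordSpan] at ha hb ⊢
    exact mul_mem_wordSpan (by rintro v rfl w rfl; simp) ha hb
  · rw [DirectSum.isInternal_submodule_iff_iSupIndep_and_iSup_eq_top]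
    constructor
    · intro n
      have hle : ⨆ j, ⨆ (_ : j ≠ n), component K X j ≤ wordSpan K X {w | w.length ≠ n} := by
        refine iSup₂_le fun j hj => ?_
        rw [component_eq_wordSpan]
        exact wordSpan_mono (by rintro w rfl; exact hj)
      refine Disjoint.mono_right hle ?_
      rw [component_eq_wordSpan]
      exact disjoint_wordSpan hX (Set.disjoint_left.2 fun w h1 h2 => h2 h1)
    · rw [eq_top_iff, ← span_range_monomial, Submodule.span_le]
      rintro _ ⟨w, rfl⟩
      exact Submodule.mem_iSup_of_mem w.length (Submodule.subset_span ⟨w, rfl, rfl⟩)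

/-! ### Projective simplicity -/

/-- If `u` forces `w`, then left multiplication by `u` isolates the coefficient of `w`. -/
lemma monomial_mul_eq_smul (hX : IsFactor X []) {u w : List S} (hw : IsFactor X w)
    (huniq : ∀ v, v.length ≤ w.length → IsFactor X (u ++ v) → v <+: w)
    {a : SubshiftAlgebra K X} (ha : a ∈ component K X w.length) :
    monomial K X u * a = coords K hX a w • monomial K X (u ++ w) := by
  classical
  induction ha using Submodule.span_induction with
  | mem x hx =>
    obtain ⟨v, hl, rfl⟩ := hx
    rw [← monomial_append, coords_monomial]
    rcases eq_or_ne v w with rfl | hne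
    · simp [hw]
    · rw [monomial_eq_zero fun h => hne ((huniq v hl.le h).eq_of_length hl)]
      split_ifs <;> simp [hne]
  | zero => simp
  | add x y _ _ hx hy => rw [mul_add, hx, hy, map_add, Finsupp.add_apply, add_smul]
  | smul r x _ hx => rw [mul_smul_comm, hx, map_smul, Finsupp.smul_apply, smul_assoc]

lemma finiteDimensional_quotient_of_monomial_mem [Finite S]
    (hF : IsUniformlyRecurrentLanguage (IsFactor X)) {I : TwoSidedIdeal (SubshiftAlgebra K X)}
    {z : List S} (hz : IsFactor X z) (hzI : monomial K X z ∈ I) :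
    FiniteDimensional K
      (SubshiftAlgebra K X ⧸ (TwoSidedIdeal.asIdeal I).restrictScalars K) := by
  obtain ⟨P, hP, hPtop⟩ := (isMonomialMap (K := K)).exists_fg_top_le hF hz
  set J := (TwoSidedIdeal.asIdeal I).restrictScalars K
  have hle : P * (K ∙ monomial K X z) * ⊤ ≤ J := by
    refine Submodule.mul_le.2 fun a ha b _ => ?_
    have ha' : a ∈ J := by
      refine Submodule.mul_le.2 (fun c _ d hd => ?_) ha
      obtain ⟨r, rfl⟩ := Submodule.mem_span_singleton.1 hd
      rw [mul_smul_comm]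
      exact J.smul_mem r (TwoSidedIdeal.mem_asIdeal.2 (I.mul_mem_left _ _ hzI))
    exact TwoSidedIdeal.mem_asIdeal.2 (I.mul_mem_right _ _ (TwoSidedIdeal.mem_asIdeal.1 ha'))
  refine ⟨Submodule.FG.of_le (hP.map J.mkQ) ?_⟩
  rintro x -
  obtain ⟨a, rfl⟩ := J.mkQ_surjective x
  obtain ⟨b, hb, c, hc, rfl⟩ := Submodule.mem_sup.1 (hPtop (Submodule.mem_top (x := a)))
  refine ⟨b, hb, ?_⟩
  rw [map_add, (J.mkQ_apply c).trans ((Submodule.Quotient.mk_eq_zero J).2 (hle hc)), add_zero]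

lemma not_finiteDimensional (hF : IsUniformlyRecurrentLanguage (IsFactor X)) :
    ¬ FiniteDimensional K (SubshiftAlgebra K X) := by
  intro h
  have : Finite {w // IsFactor X w} := (linearIndependent_monomial (K := K) hF.nil).finite
  obtain ⟨R, hR⟩ := (Set.finite_range fun w : {w // IsFactor X w} => w.1.length).bddAbove
  obtain ⟨w, hl, hw⟩ := hF.exists_length_eq (R + 1)
  have : w.length ≤ R := hR ⟨⟨w, hw⟩, rfl⟩
  omega

lemma isProjectivelySimple [Finite S] (hF : IsUniformlyRecurrentLanguage (IsFactor X)) :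
    IsProjectivelySimple (component K X) := by
  refine ⟨isAlgebraGrading hF.nil, not_finiteDimensional hF, fun I hI hne => ?_⟩
  obtain ⟨a, haI, ⟨n, han⟩, ha0⟩ :
      ∃ a ∈ I, SetLike.IsHomogeneousElem (component K X) a ∧ a ≠ 0 := by
    by_contra! H
    refine hne ?_
    rw [eq_bot_iff, ← hI, TwoSidedIdeal.span_le]
    rintro a ⟨ha, hah⟩
    rw [H a ha hah]
    exact zero_mem _
  obtain ⟨w, hw⟩ : ∃ w, coords K hF.nil a w ≠ 0 := by
    by_contra! H
    exact ha0 (coords_injective hF.nil (by rw [map_zero]; ext w; exact H w))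
  obtain ⟨hwF, rfl⟩ : IsFactor X w ∧ w.length = n :=
    mem_of_coords_ne_zero hF.nil (T := {w | w.length = n})
      (component_eq_wordSpan (K := K) (X := X) n ▸ han) hw
  obtain ⟨u, huw, huniq⟩ := hF.exists_forcing hwF
  refine finiteDimensional_quotient_of_monomial_mem hF huw ?_
  have hmem := I.mul_mem_left (monomial K X u) a haI
  rw [monomial_mul_eq_smul hF.nil hwF huniq han] at hmem
  have := ((TwoSidedIdeal.asIdeal I).restrictScalars K).smul_mem (coords K hF.nil a w)⁻¹
    (TwoSidedIdeal.mem_asIdeal.2 hmem)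
  rw [smul_smul, inv_mul_cancel₀ hw, one_smul] at this
  exact TwoSidedIdeal.mem_asIdeal.1 this

end SubshiftAlgebra

/-! ### Powers of an augmentation ideal -/

section augmentation

variable {K A : Type*} [Field K] [Ring A] [Algebra K A]

/-- If `W 1 = ker ε` as a subspace and `W i = (W 1) ^ i`, then `W i` is the `i`-th power of the left
ideal `ker ε`. -/
lemma mem_ker_pow_iff (ε : A →ₐ[K] K) {W : ℕ → Submodule K A} (h0 : W 0 = ⊤)
    (h1 : ∀ a, a - algebraMap K A (ε a) ∈ W 1) (hε : ∀ a ∈ W 1, ε a = 0)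
    (hmul : ∀ i j, W i * W j = W (i + j)) (i : ℕ) (a : A) :
    a ∈ RingHom.ker ε ^ i ↔ a ∈ W i := by
  constructor
  · intro ha
    induction i generalizing a with
    | zero => simp [h0]
    | succ i ih =>
      rw [Submodule.pow_succ] at ha
      induction ha using Submodule.mul_induction_on' with
      | mem_mul_mem x hx y hy =>
        have hy' := h1 y
        rw [RingHom.mem_ker.1 hy, map_zero, sub_zero] at hy'
        rw [← hmul]
        exact Submodule.mul_mem_mul (ih x hx) hy'
      | add x _ y _ hx hy => exact add_mem hx hy
  · intro ha
    induction i generalizing a with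
    | zero => rw [Submodule.pow_zero, Ideal.one_eq_top]; trivial
    | succ i ih =>
      rw [← hmul] at ha
      rw [Submodule.pow_succ]
      induction ha using Submodule.mul_induction_on' with
      | mem_mul_mem x hx y hy =>
        exact Submodule.mul_mem_mul (ih x hx) (RingHom.mem_ker.2 (hε y hy))
      | add x _ y _ hx hy => exact add_mem hx hy

lemma augmentationGrowth_eq_sum (ε : A →ₐ[K] K) {W C : ℕ → Submodule K A} (h0 : W 0 = ⊤)
    (h1 : ∀ a, a - algebraMap K A (ε a) ∈ W 1) (hε : ∀ a ∈ W 1, ε a = 0)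
    (hmul : ∀ i j, W i * W j = W (i + j)) (hsup : ∀ i, W i = C i ⊔ W (i + 1))
    (hdisj : ∀ i, Disjoint (C i) (W (i + 1))) (n : ℕ) :
    augmentationGrowth ε n = ∑ i ∈ Finset.range (n + 1), Module.finrank K (C i) := by
  refine Finset.sum_congr rfl fun i _ => Eq.symm ?_
  have hmem := mem_ker_pow_iff ε h0 h1 hε hmul
  have hsub : C i ≤ (RingHom.ker ε ^ i).restrictScalars K := fun a ha => by
    rw [Submodule.restrictScalars_mem, hmem, hsup]
    exact Submodule.mem_sup_left ha
  let f : C i →ₗ[K] (↥(RingHom.ker ε ^ i) ⧸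
      (RingHom.ker ε ^ (i + 1)).submoduleOf (RingHom.ker ε ^ i)) :=
    (((RingHom.ker ε ^ (i + 1)).submoduleOf (RingHom.ker ε ^ i)).mkQ.restrictScalars K) ∘ₗ
      (Submodule.inclusion hsub : C i →ₗ[K] ↥((RingHom.ker ε ^ i).restrictScalars K))
  refine LinearEquiv.finrank_eq (LinearEquiv.ofBijective f ⟨?_, ?_⟩)
  · rw [← LinearMap.ker_eq_bot, LinearMap.ker_eq_bot']
    rintro ⟨a, ha⟩ h
    have ha' : a ∈ RingHom.ker ε ^ (i + 1) :=
      (Submodule.Quotient.mk_eq_zero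
        ((RingHom.ker ε ^ (i + 1)).submoduleOf (RingHom.ker ε ^ i))).1 h
    rw [hmem] at ha'
    ext
    exact Submodule.disjoint_def.1 (hdisj i) a ha ha'
  · intro q
    obtain ⟨⟨a, ha⟩, rfl⟩ := Submodule.mkQ_surjective _ q
    have ha' := (hmem i a).1 ha
    rw [hsup] at ha'
    obtain ⟨b, hb, c, hc, rfl⟩ := Submodule.mem_sup.1 ha'
    refine ⟨⟨b, hb⟩, (Submodule.Quotient.eq _).2 ?_⟩
    change b - (b + c) ∈ RingHom.ker ε ^ (i + 1)
    rw [sub_add_cancel_left, hmem]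
    exact neg_mem hc

end augmentation

namespace SubshiftAlgebra

variable {K : Type*} [Field K] {S : Type*} [TopologicalSpace S] {X : Subshift S ℤ}

/-! ### Growth -/

lemma component_le_pow [Finite S] {V : Submodule K (SubshiftAlgebra K X)} (h1 : 1 ∈ V)
    (hV : Algebra.adjoin K (V : Set (SubshiftAlgebra K X)) = ⊤) :
    ∃ k, 0 < k ∧ ∀ n, component K X n ≤ V ^ (k * n) := by
  obtain ⟨k, hk⟩ := exists_le_pow_of_adjoin_eq_top h1 hV (fg_component (K := K) (X := X) 1)
  have hk' : component K X 1 ≤ V ^ (k + 1) :=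
    hk.trans (pow_right_mono₀ (Submodule.one_le.2 h1) (Nat.le_succ k))
  refine ⟨k + 1, Nat.succ_pos k, fun n => Submodule.span_le.2 ?_⟩
  rintro _ ⟨w, rfl, rfl⟩
  induction w with
  | nil => simpa [isMonomialMap.nil (K := K) (F := IsFactor X)] using
      Submodule.one_le.1 (le_refl (1 : Submodule K (SubshiftAlgebra K X)))
  | cons s w ih =>
    rw [isMonomialMap.cons (K := K) (F := IsFactor X), List.length_cons, Nat.mul_succ,
      add_comm, pow_add]
    exact Submodule.mul_mem_mul (hk' (Submodule.subset_span ⟨[s], rfl, rfl⟩)) ih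

lemma finiteType [Finite S] : Algebra.FiniteType K (SubshiftAlgebra K X) :=
  ⟨(Set.finite_range fun s : S => monomial K X [s]).toFinset, by
    simpa using (isMonomialMap (K := K) (X := X)).adjoin_range⟩

lemma hasExponentialGrowth [Finite S] (hX : IsFactor X []) {c : ℝ} (hc : 0 < c)
    (hp : ∀ m : ℕ, 0 < m → Real.exp (c * m) ≤ ((wordsOfLength (IsFactor X) m).ncard : ℝ)) :
    HasExponentialGrowth K (SubshiftAlgebra K X) := by
  refine ⟨finiteType, fun V hVfg h1 hV => ?_⟩
  obtain ⟨k, hk, hle⟩ := component_le_pow h1 hV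
  have hk' : (0 : ℝ) < k := by exact_mod_cast hk
  refine ⟨Real.exp (c / (2 * k)), Real.one_lt_exp_iff.2 (by positivity), ?_⟩
  filter_upwards [eventually_ge_atTop k] with n hn
  have hfin : ∀ m, Module.Finite K ↥(V ^ m) := fun m => Module.Finite.iff_fg.2 (hVfg.pow m)
  have hm : 0 < n / k := Nat.div_pos hn hk
  have hlin : (wordsOfLength (IsFactor X) (n / k)).ncard ≤ Module.finrank K ↥(V ^ n) := by
    rw [← finrank_component (K := K) hX]
    exact Submodule.finrank_mono ((hle (n / k)).trans
      (pow_right_mono₀ (Submodule.one_le.2 h1) (Nat.mul_div_le n k)))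
  have hn2 : n ≤ 2 * k * (n / k) := by
    have := Nat.lt_mul_div_succ n hk
    have := Nat.mul_le_mul_left k (Nat.succ_le_of_lt hm)
    nlinarith
  have hn2' : (n : ℝ) ≤ 2 * k * (n / k : ℕ) := by exact_mod_cast hn2
  calc Real.exp (c / (2 * k)) ^ n = Real.exp (c / (2 * k) * n) := by
        rw [← Real.exp_nat_mul, mul_comm]
    _ ≤ Real.exp (c * (n / k : ℕ)) := by
        rw [Real.exp_le_exp, div_mul_eq_mul_div, div_le_iff₀ (by positivity)]
        nlinarith
    _ ≤ _ := hp _ hm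
    _ ≤ _ := by exact_mod_cast hlin

/-! ### The augmentation -/

/-- The augmentation of `A_X` which kills all letters. -/
noncomputable def augmentation (K : Type*) [Field K] (hX : IsFactor X []) :
    SubshiftAlgebra K X →ₐ[K] K :=
  RingQuot.liftAlgHom K ⟨FreeAlgebra.lift K fun _ => 0, by
    rintro _ _ ⟨w, hw⟩
    obtain ⟨s, v, rfl⟩ := List.exists_cons_of_ne_nil (l := w) (by rintro rfl; exact hw hX)
    simp [freeMonomial]⟩

lemma augmentation_monomial_cons (hX : IsFactor X []) (s : S) (w : List S) :
    augmentation K hX (monomial K X (s :: w)) = 0 := by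
  simp [augmentation, monomial, freeMonomial]

lemma sub_algebraMap_augmentation_mem (hX : IsFactor X []) (a : SubshiftAlgebra K X) :
    a - algebraMap K _ (augmentation K hX a) ∈ wordSpan K X {w | 1 ≤ w.length} := by
  have ha : a ∈ Submodule.span K (Set.range (monomial K X)) :=
    span_range_monomial (K := K) (X := X) ▸ Submodule.mem_top
  induction ha using Submodule.span_induction with
  | mem x hx =>
    obtain ⟨_ | ⟨s, w⟩, rfl⟩ := hx
    · simp [isMonomialMap.nil (K := K) (F := IsFactor X)]
    · rw [augmentation_monomial_cons, map_zero, sub_zero]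
      exact monomial_mem_wordSpan (by simp)
  | zero => simp
  | add x y _ _ hx hy => rw [map_add, map_add, add_sub_add_comm]; exact add_mem hx hy
  | smul r x _ hx =>
    rw [map_smul, smul_eq_mul, map_mul, ← Algebra.smul_def, ← smul_sub]
    exact Submodule.smul_mem _ r hx

lemma wordSpan_le_mul (i j : ℕ) :
    wordSpan K X {w | i + j ≤ w.length} ≤
      wordSpan K X {w | i ≤ w.length} * wordSpan K X {w | j ≤ w.length} := by
  refine Submodule.span_le.2 ?_
  rintro _ ⟨w, hw, rfl⟩
  simp only [Set.mem_ofPred_eq] at hw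
  rw [← List.take_append_drop i w, monomial_append]
  exact Submodule.mul_mem_mul (monomial_mem_wordSpan (by simp; omega))
    (monomial_mem_wordSpan (by simp; omega))

lemma augmentationGrowth_augmentation [Finite S] (hX : IsFactor X []) (n : ℕ) :
    augmentationGrowth (augmentation K hX) n =
      ∑ i ∈ Finset.range (n + 1), (wordsOfLength (IsFactor X) i).ncard := by
  rw [augmentationGrowth_eq_sum (augmentation K hX) (W := fun i => wordSpan K X {w | i ≤ w.length})
    (C := component K X)]
  · simp only [finrank_component hX]
  · simp [wordSpan_univ]
  · exact sub_algebraMap_augmentation_mem hX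
  · intro a ha
    induction ha using Submodule.span_induction with
    | mem x hx =>
      obtain ⟨_ | ⟨s, w⟩, hw, rfl⟩ := hx
      · simp at hw
      · exact augmentation_monomial_cons hX s w
    | zero => simp
    | add x y _ _ hx hy => rw [map_add, hx, hy, add_zero]
    | smul r x _ hx => rw [map_smul, hx, smul_zero]
  · exact fun i j => le_antisymm (Submodule.mul_le.2 fun a ha b hb =>
      mul_mem_wordSpan (fun v hv w hw => by simp at hv hw ⊢; omega) ha hb) (wordSpan_le_mul i j)
  · intro i
    rw [component_eq_wordSpan, ← wordSpan_union]
    congr 1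
    ext w; simp; omega
  · intro i
    rw [component_eq_wordSpan]
    exact disjoint_wordSpan hX (Set.disjoint_left.2 fun w hw hw' => by simp at hw hw'; omega)

lemma growsExponentially_augmentationGrowth [Finite S] (hX : IsFactor X []) {c : ℝ} (hc : 0 < c)
    (hp : ∀ m : ℕ, 0 < m → Real.exp (c * m) ≤ ((wordsOfLength (IsFactor X) m).ncard : ℝ)) :
    GrowsExponentially (augmentationGrowth (augmentation K hX)) := by
  refine ⟨Real.exp c, Real.one_lt_exp_iff.2 hc, ?_⟩
  filter_upwards [eventually_gt_atTop 0] with n hn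
  have h1 : (wordsOfLength (IsFactor X) n).ncard ≤ augmentationGrowth (augmentation K hX) n := by
    rw [augmentationGrowth_augmentation]
    exact Finset.single_le_sum (f := fun i => (wordsOfLength (IsFactor X) i).ncard)
      (fun _ _ => Nat.zero_le _) (Finset.self_mem_range_succ n)
  rw [← Real.exp_nat_mul, mul_comm]
  exact (hp n hn).trans (by exact_mod_cast h1)

lemma allLeftModulesExhaustivelyAmenable {K : Type u} [Field K] {S : Type w}
    [TopologicalSpace S] [Finite S] {X : Subshift S ℤ}
    (hF : IsUniformlyRecurrentLanguage (IsFactor X)) :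
    AllLeftModulesExhaustivelyAmenable.{v} K (SubshiftAlgebra K X) := fun M _ _ _ _ _ =>
  isMonomialMap.isExhaustivelyAmenable hF M

lemma allRightModulesExhaustivelyAmenable {K : Type u} [Field K] {S : Type w}
    [TopologicalSpace S] [Finite S] {X : Subshift S ℤ}
    (hF : IsUniformlyRecurrentLanguage (IsFactor X)) :
    AllRightModulesExhaustivelyAmenable.{v} K (SubshiftAlgebra K X) := fun M _ _ _ _ _ =>
  isMonomialMap.op.isExhaustivelyAmenable hF.reverse M

end SubshiftAlgebra

lemma not_growsSubexponentially {f : ℕ → ℕ} (hf : GrowsExponentially f) :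
    ¬ GrowsSubexponentially f := by
  obtain ⟨β, hβ, h⟩ := hf
  intro hsub
  have hγ : 1 < (1 + β) / 2 := by linarith
  obtain ⟨n, ⟨h1, h2⟩, hn⟩ :=
    ((h.and (hsub _ hγ)).and (eventually_gt_atTop 0)).exists
  have h3 : ((1 + β) / 2) ^ n < β ^ n :=
    pow_lt_pow_left₀ (by linarith) (by linarith) (by omega)
  linarith

/-! ### Concatenations of words of equal length -/

section flatten

variable {S : Type*}

lemma length_flatten_of_forall {L : List (List S)} {l : ℕ} (h : ∀ c ∈ L, c.length = l) :
    L.flatten.length = L.length * l := by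
  rw [List.length_flatten, List.map_congr_left h]
  simp

lemma eq_of_flatten_eq {L L' : List (List S)} {l : ℕ} (hL : ∀ c ∈ L, c.length = l)
    (hL' : ∀ c ∈ L', c.length = l) (hlen : L.length = L'.length)
    (h : L.flatten = L'.flatten) : L = L' := by
  rw [List.eq_iff_flatten_eq]
  refine ⟨h, ?_⟩
  rw [List.map_congr_left hL, List.map_congr_left hL']
  simp [hlen]

lemma exists_flatten_eq_flatten {P : List S → Prop} {L : List (List S)}
    (h : ∀ c ∈ L, ∃ L' : List (List S), (∀ b ∈ L', P b) ∧ c = L'.flatten) :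
    ∃ L' : List (List S), (∀ b ∈ L', P b) ∧ L.flatten = L'.flatten := by
  induction L with
  | nil => exact ⟨[], by simp, rfl⟩
  | cons c L ih =>
    obtain ⟨L₁, h1, rfl⟩ := h c (by simp)
    obtain ⟨L₂, h2, h3⟩ := ih fun c hc => h c (by simp [hc])
    refine ⟨L₁ ++ L₂, fun b hb => ?_, by simp [h3]⟩
    rcases List.mem_append.1 hb with hb | hb
    exacts [h1 b hb, h2 b hb]

/-- A long factor of a concatenation of words of length `l` contains one of these words. -/
lemma exists_mem_isInfix_of_isInfix_flatten {L : List (List S)} {l : ℕ} (hl : 0 < l)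
    (hL : ∀ c ∈ L, c.length = l) {v : List S} (hv : v <:+: L.flatten) (hlen : 2 * l ≤ v.length) :
    ∃ c ∈ L, c <:+: v := by
  induction L with
  | nil =>
    have := hv.length_le
    rw [List.flatten_nil, List.length_nil] at this
    omega
  | cons c L ih =>
    have hc : c.length = l := hL c (by simp)
    obtain ⟨p, q, hpq⟩ := hv
    rw [List.flatten_cons] at hpq
    rcases le_or_gt l p.length with hp | hp
    · obtain ⟨c', hc', hcv⟩ := ih (fun c hc => hL c (by simp [hc])) (by
        refine ⟨p.drop l, q, ?_⟩
        have := congrArg (List.drop l) hpq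
        rwa [List.append_assoc, List.drop_append_of_le_length hp, List.drop_left' hc,
          ← List.append_assoc] at this)
      exact ⟨c', by simp [hc'], hcv⟩
    · -- `v` starts inside `c`, hence contains the next word `d` entirely
      rcases L with _ | ⟨d, L⟩
      · have := congrArg List.length hpq
        simp at this
        omega
      · have hd : d.length = l := hL d (by simp)
        refine ⟨d, by simp, ?_⟩
        have h1 := congrArg (fun z => (z.drop l).take l) hpq
        simp only [List.flatten_cons] at h1
        rw [List.drop_left' hc, List.take_left' hd, List.append_assoc, List.drop_append,
          List.drop_of_length_le hp.le, List.nil_append, List.drop_append_of_le_length (by omega),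
          List.take_append_of_le_length (by simp; omega)] at h1
        rw [← h1]
        exact (List.take_prefix _ _).isInfix.trans (List.drop_suffix _ _).isInfix

end flatten

/-! ### A minimal subshift of exponential complexity -/

namespace RichSubshift

open Classical in
/-- The words obtained from a finite set `B` of words by concatenating all of them, in a fixed
order, and then `m` arbitrary words of `B`. -/
noncomputable def nextBlocks (B : Finset (List Bool)) (m : ℕ) : Finset (List Bool) :=
  Finset.univ.image fun f : Fin m → B => (B.toList ++ List.ofFn fun i => (f i : List Bool)).flatten

/-- The blocks of level `k`. The number of free choices is taken so large with respect to the number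
of blocks that the exponential rate `log (card) / length` decreases only by the factor
`(k + 1) (k + 3) / (k + 2) ^ 2` from level `k` to level `k + 1`; these factors have product
`1 / 2`. -/
noncomputable def blocks : ℕ → Finset (List Bool)
  | 0 => {[false], [true]}
  | k + 1 => nextBlocks (blocks k) ((blocks k).card * ((k + 1) * (k + 3)))

/-- The length of the blocks of level `k`. -/
noncomputable def blockLength : ℕ → ℕ
  | 0 => 1
  | k + 1 => (blocks k).card * (k + 2) ^ 2 * blockLength k

lemma mem_nextBlocks {B : Finset (List Bool)} {m : ℕ} {b : List Bool} :
    b ∈ nextBlocks B m ↔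
      ∃ f : Fin m → B, (B.toList ++ List.ofFn fun i => (f i : List Bool)).flatten = b := by
  simp [nextBlocks]

lemma forall_mem_append_ofFn {B : Finset (List Bool)} {m : ℕ} (f : Fin m → B) :
    ∀ c ∈ B.toList ++ List.ofFn fun i => (f i : List Bool), c ∈ B := by
  intro c hc
  simp only [List.mem_append, Finset.mem_toList, List.mem_ofFn] at hc
  rcases hc with hc | ⟨i, rfl⟩
  exacts [hc, (f i).2]

lemma length_of_mem_blocks {k : ℕ} {b : List Bool} (hb : b ∈ blocks k) :
    b.length = blockLength k := by
  induction k generalizing b with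
  | zero =>
    simp only [blocks, Finset.mem_insert, Finset.mem_singleton] at hb
    rcases hb with rfl | rfl <;> rfl
  | succ k ih =>
    rw [blocks, mem_nextBlocks] at hb
    obtain ⟨f, rfl⟩ := hb
    rw [length_flatten_of_forall fun c hc => ih (forall_mem_append_ofFn f c hc), blockLength]
    simp only [List.length_append, Finset.length_toList, List.length_ofFn]
    ring

lemma card_blocks_succ (k : ℕ) :
    (blocks (k + 1)).card = (blocks k).card ^ ((blocks k).card * ((k + 1) * (k + 3))) := by
  rw [blocks, nextBlocks, Finset.card_image_of_injective]
  · simp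
  · intro f g h
    have hlen : ∀ f : Fin ((blocks k).card * ((k + 1) * (k + 3))) → blocks k,
        ∀ c ∈ (blocks k).toList ++ List.ofFn fun i => (f i : List Bool),
          c.length = blockLength k :=
      fun f c hc => length_of_mem_blocks (forall_mem_append_ofFn f c hc)
    have := List.append_cancel_left (eq_of_flatten_eq (hlen f) (hlen g) (by simp) h)
    exact funext fun i => Subtype.ext (congrFun (List.ofFn_injective this) i)

lemma card_blocks_pow (k : ℕ) :
    (blocks k).card ^ (2 * (k + 1)) = 2 ^ (blockLength k * (k + 2)) := by
  induction k with
  | zero => simp [blocks, blockLength]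
  | succ k ih =>
    calc (blocks (k + 1)).card ^ (2 * (k + 1 + 1))
        = ((blocks k).card ^ (2 * (k + 1))) ^ ((blocks k).card * (k + 3) * (k + 2)) := by
          rw [card_blocks_succ, ← pow_mul, ← pow_mul]; congr 1; ring
      _ = 2 ^ (blockLength (k + 1) * (k + 1 + 2)) := by
          rw [ih, ← pow_mul, blockLength]; congr 1; ring

lemma two_pow_blockLength_le (k : ℕ) : 2 ^ blockLength k ≤ (blocks k).card ^ 2 := by
  rw [← Nat.pow_le_pow_iff_left (Nat.succ_ne_zero k), ← pow_mul, ← pow_mul, card_blocks_pow]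
  exact Nat.pow_le_pow_right two_pos (Nat.mul_le_mul_left _ (by omega))

lemma card_blocks_pos (k : ℕ) : 0 < (blocks k).card := by
  by_contra h
  have := two_pow_blockLength_le k
  rw [Nat.eq_zero_of_not_pos h] at this
  simp at this

lemma lt_blockLength (k : ℕ) : k < blockLength k := by
  induction k with
  | zero => simp [blockLength]
  | succ k ih =>
    rw [blockLength]
    have h1 := card_blocks_pos k
    calc k + 1 < 1 * 2 ^ 2 * (k + 1) := by omega
      _ ≤ (blocks k).card * (k + 2) ^ 2 * blockLength k := by gcongr <;> omega

lemma strictMono_blockLength : StrictMono blockLength := by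
  refine strictMono_nat_of_lt_succ fun k => ?_
  rw [blockLength]
  have h1 := card_blocks_pos k
  have h2 := lt_blockLength k
  calc blockLength k < 1 * 2 ^ 2 * blockLength k := by omega
    _ ≤ _ := by gcongr <;> omega

lemma isInfix_of_mem_blocks_succ {k : ℕ} {b c : List Bool} (hb : b ∈ blocks k)
    (hc : c ∈ blocks (k + 1)) : b <:+: c := by
  rw [blocks, mem_nextBlocks] at hc
  obtain ⟨f, rfl⟩ := hc
  exact List.infix_of_mem_flatten (by simp [hb])

lemma exists_eq_flatten {j k : ℕ} (hjk : j ≤ k) {b : List Bool} (hb : b ∈ blocks k) :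
    ∃ L : List (List Bool), (∀ c ∈ L, c ∈ blocks j) ∧ b = L.flatten := by
  induction k, hjk using Nat.le_induction generalizing b with
  | base => exact ⟨[b], by simpa using hb, by simp⟩
  | succ k _ ih =>
    rw [blocks, mem_nextBlocks] at hb
    obtain ⟨f, rfl⟩ := hb
    exact exists_flatten_eq_flatten fun c hc => ih (forall_mem_append_ofFn f c hc)

/-- The factors of the blocks of all levels. -/
def blockLanguage (w : List Bool) : Prop :=
  ∃ k, ∃ b ∈ blocks k, w <:+: b

lemma blockLanguage_of_isInfix {v w : List Bool} (h : v <:+: w) (hw : blockLanguage w) :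
    blockLanguage v :=
  hw.imp fun _ ⟨b, hb, hwb⟩ => ⟨b, hb, h.trans hwb⟩

lemma exists_forall_isInfix {w : List Bool} (hw : blockLanguage w) :
    ∃ R, ∀ v, blockLanguage v → R ≤ v.length → w <:+: v := by
  obtain ⟨k, b, hb, hwb⟩ := hw
  refine ⟨2 * blockLength (k + 1), fun v ⟨j, c, hc, hvc⟩ hlen => ?_⟩
  have hpos : 0 < blockLength (k + 1) := (Nat.zero_le _).trans_lt (lt_blockLength _)
  have hj : k + 1 ≤ j := by
    rw [← strictMono_blockLength.le_iff_le, ← length_of_mem_blocks hc]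
    have := hvc.length_le
    omega
  obtain ⟨L, hL, rfl⟩ := exists_eq_flatten hj hc
  obtain ⟨d, hd, hdv⟩ := exists_mem_isInfix_of_isInfix_flatten hpos
    (fun c hc => length_of_mem_blocks (hL c hc)) hvc hlen
  exact hwb.trans ((isInfix_of_mem_blocks_succ hb (hL d hd)).trans hdv)

/-- The subshift of the sequences all of whose words are factors of blocks. -/
def subshift : Subshift Bool ℤ :=
  restrictSubshift (fullShift Bool ℤ) blockLanguage

lemma subshift_nonempty : subshift.carrier.Nonempty := by
  refine exists_forall_window (fullShift Bool ℤ).isClosed blockLanguage_of_isInfix fun n => ?_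
  obtain ⟨b, hb⟩ := Finset.card_pos.1 (card_blocks_pos (2 * n))
  have hl : 2 * n < b.length := by rw [length_of_mem_blocks hb]; exact lt_blockLength _
  refine ⟨fun i => b.getD (i + n).toNat false, trivial, 2 * n, b, hb, ?_⟩
  have : window (fun i => b.getD (i + n).toNat false) (-n) (2 * n) = b.take (2 * n) := by
    refine List.ext_getElem (by simp; omega) fun k h1 h2 => ?_
    simp at h1
    simp [window, List.getElem?_eq_getElem (show k < b.length by omega)]
  rw [this]
  exact (List.take_prefix _ _).isInfix

lemma isFactor_subshift_iff {w : List Bool} : IsFactor subshift w ↔ blockLanguage w := by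
  constructor
  · rw [isFactor_iff]
    rintro ⟨x, hx, i, hi⟩
    rw [hi]
    exact hx.2 _ _
  · intro hw
    obtain ⟨R, hR⟩ := exists_forall_isInfix hw
    obtain ⟨x, hx⟩ := subshift_nonempty
    exact (isFactor_window hx 0 R).of_isInfix (hR _ (hx.2 0 R) (by simp))

lemma isMinimalSubshift : IsMinimalSubshift subshift := by
  refine isMinimalSubshift_of_forall_isInfix subshift_nonempty fun w hw x hx => ?_
  obtain ⟨R, hR⟩ := exists_forall_isInfix (isFactor_subshift_iff.1 hw)
  exact ⟨0, R, hR _ (hx.2 0 R) (by simp)⟩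

lemma exp_le_ncard_wordsOfLength {m : ℕ} (hm : 0 < m) :
    Real.exp (Real.log 2 / 2 * m) ≤ ((wordsOfLength (IsFactor subshift) m).ncard : ℝ) := by
  refine isMinimalSubshift.isUniformlyRecurrentLanguage.exp_le_ncard_wordsOfLength (r := 0) ?_ hm
  refine (tendsto_atTop_mono (fun k => (lt_blockLength k).le) tendsto_id).frequently
    (Frequently.of_forall fun k => ?_)
  have h1 : (blocks k).card ≤ (wordsOfLength (IsFactor subshift) (blockLength k)).ncard := by
    rw [← Set.ncard_coe_finset]
    exact Set.ncard_le_ncard (fun b hb => ⟨isFactor_subshift_iff.2 ⟨k, b, hb, List.infix_rfl⟩,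
      length_of_mem_blocks hb⟩) (finite_wordsOfLength _ _)
  have h2 : (2 : ℝ) ^ blockLength k ≤ ((blocks k).card : ℝ) ^ 2 := by
    exact_mod_cast two_pow_blockLength_le k
  have h3 : Real.exp (Real.log 2 / 2 * blockLength k) ^ 2 = 2 ^ blockLength k := by
    rw [← Real.exp_nat_mul, ← Real.exp_log (two_pos (α := ℝ)), ← Real.exp_nat_mul,
      Real.exp_log two_pos]
    congr 1
    push_cast
    ring
  calc _ ≤ ((blocks k).card : ℝ) :=
        le_of_sq_le_sq (by rw [h3]; exact h2) (by positivity)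
    _ ≤ _ := by exact_mod_cast h1

end RichSubshift

/-! ### Failure of the extension of Vershik's conjecture -/

theorem corollary4p2 (K : Type u) [Field K] :
    (∀ (S : Type w) [Finite S] [UniformSpace S] [DiscreteUniformity S] (X : Subshift S ℤ),
      IsMinimalSubshift X → 0 < subshiftEntropy X →
        IsAlgebraGrading (SubshiftAlgebra.component K X) ∧
        IsProjectivelySimple (SubshiftAlgebra.component K X) ∧
        HasExponentialGrowth K (SubshiftAlgebra K X) ∧
        AllRightModulesExhaustivelyAmenable.{v} K (SubshiftAlgebra K X) ∧
        AllLeftModulesExhaustivelyAmenable.{v} K (SubshiftAlgebra K X) ∧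
        ∃ ε : SubshiftAlgebra K X →ₐ[K] K,
          (∀ s : S, ε (SubshiftAlgebra.monomial K X [s]) = 0) ∧
          GrowsExponentially (augmentationGrowth ε)) ∧
    ¬ BartholdiVershikConjecture K := by
  constructor
  · intro S _ _ _ X hX hent
    have hF := hX.isUniformlyRecurrentLanguage
    obtain ⟨c, hc, hp⟩ := exists_exp_le_ncard_wordsOfLength hX hent
    exact ⟨SubshiftAlgebra.isAlgebraGrading hF.nil, SubshiftAlgebra.isProjectivelySimple hF,
      SubshiftAlgebra.hasExponentialGrowth hF.nil hc hp,
      SubshiftAlgebra.allRightModulesExhaustivelyAmenable hF,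
      SubshiftAlgebra.allLeftModulesExhaustivelyAmenable hF,
      SubshiftAlgebra.augmentation K hF.nil,
      fun s => SubshiftAlgebra.augmentation_monomial_cons hF.nil s [],
      SubshiftAlgebra.growsExponentially_augmentationGrowth hF.nil hc hp⟩
  · intro hconj
    have hF := RichSubshift.isMinimalSubshift.isUniformlyRecurrentLanguage
    refine not_growsSubexponentially (SubshiftAlgebra.growsExponentially_augmentationGrowth
      (K := K) hF.nil (by positivity) fun m hm => RichSubshift.exp_le_ncard_wordsOfLength hm)
      (hconj (SubshiftAlgebra K RichSubshift.subshift) _ SubshiftAlgebra.finiteType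
        (SubshiftAlgebra.allRightModulesExhaustivelyAmenable hF)
        (SubshiftAlgebra.allLeftModulesExhaustivelyAmenable hF))
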